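/- Let $X$ be a finite simplicial complex (a finite collection of finite sets closed under inclusion and containing $\emptyset$) with a total order on its vertices. Write $\dim\sigma=|\sigma|-1$, let $X_k$ be the set of $k$-dimensional faces of $X$, let $V(X)$ be the union of all faces, and for $\sigma\in X_k$ let $\deg_X(\sigma)$ be the number of faces in $X_{k+1}$ containing $\sigma$ and $\sigma_{k-1}=\{\tau\in X_{k-1}:\tau\subseteq\sigma\}$. For a subcomplex $A\subseteq X$, let $C_k(X,A;\mathbb R)=C_k(X;\mathbb R)/C_k(A;\mathbb R)$ be the relative simplicial chain groups, with orthonormal basis the (classes of) oriented faces in $X_k\setminus A_k$, let $\partial_k:C_k(X,A;\mathbb R)\to C_{k-1}(X,A;\mathbb R)$ be the relative boundary map and $\partial_k^*$ its adjoint, and, when $X_k\setminus A_k\neq\emptyset$, let $\mu_k(X,A)$ be the smallest eigenvalue of $L_k(X,A)=\partial_{k+1}\partial_{k+1}^*+\partial_k^*\partial_k$. Let $k\ge 1$ and let $A$ be a $k$-th discrete boundary of $X$, that is, a subcomplex of $X$ such that $\deg_X(\sigma)\le 1$ for every $\sigma\in A_{k-1}$. Assume that $X_k\setminus A_k\ne\emptyset$,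 and let $$X'=\Big\{\sigma : \sigma\subseteq\tau\text{ for some }\tau\in (X_k\setminus A_k)\cup\bigcup_{i\ge k+1}X_i\Big\}.$$ Let $n'=|V(X')|$, and let $h'$ be the maximal dimension of a missing face of $X'$, that is, of a set $\sigma\subseteq V(X')$ with $\sigma\notin X'$ all of whose proper subsets belong to $X'$; put $h'=0$ if $X'$ has no missing face (that is, if $X'$ is a full simplex). Then $$\begin{aligned}\mu_k(X,A)&\ge \min_{\sigma\in X'_k}\big((h'+1)\deg_{X'}(\sigma)-|\sigma_{k-1}\cap A_{k-1}|\big)+(h'+1)(k+1)-h'n'\\&\ge (h'+1)(k+1)-h'n'-\max_{\sigma\in X'_k}|\sigma_{k-1}\cap A_{k-1}|.\end{aligned}$$ Moreover, $\mu_k(X,A)=(h'+1)(k+1)-h'n'-\max_{\sigma\in X'_k}|\sigma_{k-1}\cap A_{k-1}|$ if and only if $n'-k-1\ge 0$, $(h'+1)(k+1)-h'n'\ge 0$, $$X'\cong\big(\Delta^{h'}_{(h'-1)}\big)^{*(n'-k-1)}*\Delta^{(h'+1)(k+1)-h'n'-1},$$ and $|\sigma_{k-1}\cap A_{k-1}|$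 takes the same value for all $\sigma\in X'_k$. Here $\Delta^m$ is the complex of all subsets of an $(m+1)$-element set (so $\Delta^{-1}=\{\emptyset\}$), $Y_{(p)}$ is the subcomplex of the faces of $Y$ of dimension at most $p$, $Y*Z=\{\sigma\cup\tau:\sigma\in Y,\tau\in Z\}$ is the join of complexes on disjoint vertex sets, $Y^{*r}$ is the join of $r$ disjoint copies of $Y$ (with $Y^{*0}=\{\emptyset\}$), and $\cong$ means that a bijection of the vertex sets is simplicial in both directions. -/

import Mathlib

/-- A finite simplicial complex with vertices in `V`: a finite collection of finite sets that is
closed under inclusion. The empty set (of dimension `-1`) is always a face. An element of `V`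
need not be a vertex of the complex. -/
structure FinComplex (V : Type*) where
  /-- the faces, the empty face included -/
  faces : Finset (Finset V)
  empty_mem : ∅ ∈ faces
  down_closed : ∀ σ ∈ faces, ∀ τ ⊆ σ, τ ∈ faces

namespace FinComplex

variable {V W : Type*}

/-- The dimension of a finite set: its number of elements minus one. -/
def dim (σ : Finset V) : ℤ := (σ.card : ℤ) - 1

/-- `X_k`, the set of `k`-dimensional faces of `X`. -/
def facesOfDim (X : FinComplex V) (k : ℤ) : Finset (Finset V) :=
  X.faces.filter (fun σ => dim σ = k)

/-- The vertex set of `X`: the union of all its faces. -/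
def vertices [DecidableEq V] (X : FinComplex V) : Finset V := X.faces.biUnion id

/-- `A` is a subcomplex of `X`. -/
def IsSubcomplex (A X : FinComplex V) : Prop := A.faces ⊆ X.faces

/-- The degree of a face `σ` of dimension `k`: the number of `(k+1)`-faces containing `σ`. -/
def degree [DecidableEq V] (X : FinComplex V) (σ : Finset V) : ℕ :=
  ((X.facesOfDim (dim σ + 1)).filter (fun η => σ ⊆ η)).card

/-- The set of `j`-dimensional faces of `X` contained in `σ`. -/
def facesIn [DecidableEq V] (X : FinComplex V) (σ : Finset V) (j : ℤ) : Finset (Finset V) :=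
  (X.facesOfDim j).filter (fun τ => τ ⊆ σ)

/-- The missing faces of `X`: the sets of vertices that are not faces, although all their
proper subsets are. -/
def missingFaces [DecidableEq V] (X : FinComplex V) : Finset (Finset V) :=
  X.vertices.powerset.filter (fun σ => σ ∉ X.faces ∧ ∀ τ ∈ σ.ssubsets, τ ∈ X.faces)

/-- `h(X)`, the maximal dimension of a missing face of `X`. A missing face has at least two
elements. If there are none (that is, if `X` consists of all subsets of its vertex set),
then `h(X) = 0`. -/
def missingDim [DecidableEq V] (X : FinComplex V) : ℕ :=
  X.missingFaces.sup (fun σ => σ.card - 1)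

/-- The `p`-dimensional skeleton of `X`, for `p ≥ -1`: the faces of dimension at most `p`. -/
def skeleton [DecidableEq V] (X : FinComplex V) (p : ℤ) : FinComplex V where
  faces := X.faces.filter (fun σ => σ = ∅ ∨ dim σ ≤ p)
  empty_mem := by simp [X.empty_mem]
  down_closed := by
    intro σ hσ τ hτ
    simp only [Finset.mem_filter] at hσ ⊢
    refine ⟨X.down_closed σ hσ.1 τ hτ, ?_⟩
    rcases hσ.2 with h | h
    · left
      subst h
      exact Finset.subset_empty.mp hτ
    · right
      have := Finset.card_le_card hτ
      unfold dim at *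
      omega

/-- `Δ^m`, the complex of all subsets of a set with `m + 1` elements, for `m ≥ -1`;
`Δ^{-1}` has the empty face only. -/
def simplex (m : ℤ) : FinComplex (Fin (m + 1).toNat) where
  faces := Finset.univ
  empty_mem := Finset.mem_univ _
  down_closed := fun _ _ _ _ => Finset.mem_univ _

/-- The join `X * Y`. The vertex sets are made disjoint by passing to the sum type, and
`σ.disjSum τ` is the union of `σ` and `τ` there. -/
def join [DecidableEq V] [DecidableEq W] (X : FinComplex V) (Y : FinComplex W) :
    FinComplex (V ⊕ W) where
  faces := (X.faces ×ˢ Y.faces).image (fun p => p.1.disjSum p.2)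
  empty_mem := Finset.mem_image.mpr
    ⟨(∅, ∅), Finset.mem_product.mpr ⟨X.empty_mem, Y.empty_mem⟩, by simp⟩
  down_closed := by
    intro ρ hρ τ hτ
    simp only [Finset.mem_image, Finset.mem_product, Prod.exists] at hρ ⊢
    obtain ⟨a, b, ⟨ha, hb⟩, rfl⟩ := hρ
    refine ⟨τ.toLeft, τ.toRight, ⟨X.down_closed a ha _ ?_, Y.down_closed b hb _ ?_⟩,
      Finset.toLeft_disjSum_toRight⟩
    · intro v hv
      simpa using hτ (Finset.mem_toLeft.mp hv)
    · intro v hv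
      simpa using hτ (Finset.mem_toRight.mp hv)

/-- The part of `σ ⊆ {0, …, n-1} × V` in the `i`-th copy of `V`. -/
def slice [DecidableEq V] {n : ℕ} (σ : Finset (Fin n × V)) (i : Fin n) : Finset V :=
  (σ.filter (fun p => p.1 = i)).image Prod.snd

/-- The `n`-fold join `X^{*n}` of disjoint copies of `X`: a face is a union of faces, one in each
of the `n` copies. For `n = 0` only the empty face is left. -/
def joinPow [DecidableEq V] (X : FinComplex V) (n : ℕ) : FinComplex (Fin n × V) where
  faces := (Finset.univ ×ˢ X.vertices).powerset.filter (fun σ => ∀ i, slice σ i ∈ X.faces)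
  empty_mem := by
    rw [Finset.mem_filter]
    exact ⟨Finset.empty_mem_powerset _, fun i => by simpa [slice] using X.empty_mem⟩
  down_closed := by
    intro σ hσ τ hτ
    simp only [Finset.mem_filter, Finset.mem_powerset] at hσ ⊢
    refine ⟨hτ.trans hσ.1, fun i => X.down_closed _ (hσ.2 i) _ ?_⟩
    exact Finset.image_subset_image (Finset.filter_subset_filter _ hτ)

/-- A map between the vertex sets is simplicial if it takes faces to faces. -/
def IsSimplicialMap [DecidableEq V] [DecidableEq W] (X : FinComplex V) (Y : FinComplex W)
    (f : X.vertices → Y.vertices) : Prop :=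
  ∀ σ : Finset X.vertices, σ.map (Function.Embedding.subtype _) ∈ X.faces →
    (σ.image f).map (Function.Embedding.subtype _) ∈ Y.faces

/-- `X ≅ Y`: some bijection of the vertex sets is simplicial in both directions. -/
def Isomorphic [DecidableEq V] [DecidableEq W] (X : FinComplex V) (Y : FinComplex W) : Prop :=
  ∃ f : X.vertices ≃ Y.vertices, IsSimplicialMap X Y f ∧ IsSimplicialMap Y X f.symm

/-- The `k`-faces of `X` that are not faces of `A`; they index the basis of the relative chain
group `C_k(X, A; ℝ)`. -/
def relFaces [DecidableEq V] (X A : FinComplex V) (k : ℤ) : Finset (Finset V) :=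
  X.facesOfDim k \ A.facesOfDim k

/-- The incidence number of `η` in `σ = {v_0 < ⋯ < v_k}`: it is `(-1)^i` if
`η = σ \ {v_i}`, and `0` if `η` is not obtained from `σ` by removing one vertex. -/
def incidence [LinearOrder V] (η σ : Finset V) : ℝ :=
  ∑ v ∈ σ, if η = σ.erase v then (-1 : ℝ) ^ (σ.filter (fun w => w < v)).card else 0

/-- The matrix of the relative boundary map `∂_k : C_k(X, A; ℝ) → C_j(X, A; ℝ)`, `j = k - 1`, in
the bases of oriented faces. -/
def relBoundary [LinearOrder V] (X A : FinComplex V) (j k : ℤ) :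
    Matrix (relFaces X A j) (relFaces X A k) ℝ :=
  Matrix.of (fun η σ => incidence η.1 σ.1)

/-- The relative Laplacian `L_k(X, A) = ∂_{k+1} ∂_{k+1}^* + ∂_k^* ∂_k`. -/
def relLaplacian [LinearOrder V] (X A : FinComplex V) (k : ℤ) :
    Matrix (relFaces X A k) (relFaces X A k) ℝ :=
  relBoundary X A k (k + 1) * (relBoundary X A k (k + 1)).transpose +
    (relBoundary X A (k - 1) k).transpose * relBoundary X A (k - 1) k

/-- `μ_k(X, A)`, the smallest eigenvalue of the relative Laplacian `L_k(X, A)`. It is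
meaningful if `X` has a `k`-face outside `A`. -/
noncomputable def spectralGap [LinearOrder V] (X A : FinComplex V) (k : ℤ) : ℝ :=
  sInf {μ : ℝ | Module.End.HasEigenvalue (Matrix.toLin' (relLaplacian X A k)) μ}

theorem spectralGap_isLeast [LinearOrder V] (X A : FinComplex V) (k : ℤ)
    (hne : (relFaces X A k).Nonempty) :
    IsLeast {μ : ℝ | Module.End.HasEigenvalue (Matrix.toLin' (relLaplacian X A k)) μ}
      (spectralGap X A k) := by
  have hH : (relLaplacian X A k).IsHermitian := by
    unfold relLaplacian Matrix.IsHermitian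
    simp [Matrix.conjTranspose_eq_transpose_of_trivial, Matrix.transpose_add,
      Matrix.transpose_mul]
  obtain ⟨σ, hσ⟩ := hne
  have hfin : {μ : ℝ | Module.End.HasEigenvalue
      (Matrix.toLin' (relLaplacian X A k)) μ}.Finite :=
    Module.End.finite_hasEigenvalue _
  refine ⟨Set.Nonempty.csInf_mem ⟨hH.eigenvalues ⟨σ, hσ⟩, ?_⟩ hfin, fun μ hμ =>
    csInf_le hfin.bddBelow hμ⟩
  have := hH.eigenvalues_mem_spectrum_real ⟨σ, hσ⟩
  rw [← Matrix.spectrum_toLin'] at this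
  exact Module.End.hasEigenvalue_iff_mem_spectrum.mpr this

/-- `A` is a `k`-th discrete boundary of `X`: a subcomplex all of whose `(k-1)`-faces have degree
at most one in `X`. -/
def IsDiscreteBoundary [DecidableEq V] (X A : FinComplex V) (k : ℤ) : Prop :=
  IsSubcomplex A X ∧ ∀ σ ∈ A.facesOfDim (k - 1), X.degree σ ≤ 1

/-- `X'`, the subcomplex of `X` generated by the `k`-faces of `X` not in `A` together with all
faces of `X` of dimension at least `k + 1`. -/
def outerPart [DecidableEq V] (X A : FinComplex V) (k : ℤ) : FinComplex V where
  faces := X.faces.filter (fun σ => σ = ∅ ∨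
    ∃ τ ∈ X.faces, (τ ∈ relFaces X A k ∨ k + 1 ≤ dim τ) ∧ σ ⊆ τ)
  empty_mem := by simp [X.empty_mem]
  down_closed := by
    intro σ hσ τ hτ
    simp only [Finset.mem_filter] at hσ ⊢
    refine ⟨X.down_closed σ hσ.1 τ hτ, ?_⟩
    rcases hσ.2 with h | ⟨ρ, h1, h2, h3⟩
    · left
      subst h
      exact Finset.subset_empty.mp hτ
    · exact Or.inr ⟨ρ, h1, h2, hτ.trans h3⟩

theorem outerPart_nonempty [DecidableEq V] {X A : FinComplex V} {k : ℤ}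
    (hne : (relFaces X A k).Nonempty) : ((outerPart X A k).facesOfDim k).Nonempty := by
  obtain ⟨σ, hσ⟩ := hne
  have h := hσ
  simp only [relFaces, Finset.mem_sdiff, facesOfDim, Finset.mem_filter] at h
  refine ⟨σ, ?_⟩
  simp only [facesOfDim, outerPart, Finset.mem_filter]
  exact ⟨⟨h.1.1, Or.inr ⟨σ, h.1.1, Or.inl hσ, Finset.Subset.refl σ⟩⟩, h.1.2⟩

/-- `|σ_{k-1} ∩ A_{k-1}|`, the number of `(k-1)`-faces of `σ` that lie in `A`. -/
def boundaryCount [DecidableEq V] (X A : FinComplex V) (k : ℤ) (σ : Finset V) : ℕ :=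
  (X.facesIn σ (k - 1) ∩ A.facesOfDim (k - 1)).card

/-- The complex `(Δ^h_{(h-1)})^{*(n-k-1)} * Δ^{(h+1)(k+1)-hn-1}`; the integers `n - k - 1` and
`(h + 1) * (k + 1) - h * n` are meant to be nonnegative. -/
def extremalComplex (h n : ℕ) (k : ℤ) :
    FinComplex ((Fin ((n : ℤ) - k - 1).toNat × Fin ((h : ℤ) + 1).toNat) ⊕
      Fin (((h : ℤ) + 1) * (k + 1) - h * n - 1 + 1).toNat) :=
  join (joinPow (skeleton (simplex (h : ℤ)) ((h : ℤ) - 1)) ((n : ℤ) - k - 1).toNat)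
    (simplex (((h : ℤ) + 1) * (k + 1) - h * n - 1))

end FinComplex

namespace FinComplex

variable {V : Type*}

/-! Everything rests on one formula, `relLaplacian_mulVec`. On the basis of `k`-faces outside `A`,
which are exactly the `k`-faces of `X'`, the Laplacian has diagonal entry `k + 1 + deg(σ) - |σ_{k-1}
∩ A_{k-1}|` at `σ`, with the degree taken in `X'`. Its off-diagonal entries in the row of `σ` are
`±1`, one for each swap: an exchange of `u ∈ σ` for `v ∉ σ` that gives a face of `X'` while `σ ∪
{v}` is not a face. If `σ ∪ {v}` is a face, the contributions of `∂∂*` and `∂*∂` cancel.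
Discreteness of the boundary is what keeps `A` out of the off-diagonal part: a `(k-1)`-face with two
cofaces never lies in `A`.

Lower bound. If `σ ∪ {v}` is not a face, it contains a missing face through `v`, and every `u`
exchangeable for `v` lies in that missing face. So each such `v` has at most `h'` swaps, and there
are `n' - k - 1 - deg(σ)` such `v` (`card_swaps_le`). Gershgorin's estimate at a face where an
eigenvector has maximal modulus gives the first inequality; the second follows from `deg ≥ 0`.

Equality. If the weaker bound is attained, every estimate is sharp at a face of maximal modulus
(`tight_of_spectralGap_eq`): its degree is zero, every outside vertex has exactly `h'` swaps, and
swapped faces have maximal modulus too. Two vertices cannot be exchanged for the same `u`, since the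
resulting triangle of swaps would have incompatible signs. Hence the missing faces met at one
maximal face are disjoint sets of `h' + 1` vertices, and repeated swaps reach the complements of all
their transversals; this determines `X'` (`isBoundaryJoin_of_swaps`).

Conversely, on such a join with blocks `P i`, assign vectors in `ℝ^{k+1}` to the vertices so that
each block sums to zero. The determinants of the vectors of the `k`-faces form an eigenvector: by
multilinearity each swap contributes `-z(σ)`, so the Gershgorin value is attained
(`spectralGap_le_of_isBoundaryJoin`). -/

theorem mem_facesOfDim {X : FinComplex V} {k : ℤ} {σ : Finset V} :
    σ ∈ X.facesOfDim k ↔ σ ∈ X.faces ∧ (σ.card : ℤ) = k + 1 := by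
  rw [facesOfDim, Finset.mem_filter, dim, sub_eq_iff_eq_add]

/-! ### Missing faces, discrete boundaries and the number of swaps -/

section DecEq
variable [DecidableEq V]

theorem mem_relFaces {X A : FinComplex V} {k : ℤ} {σ : Finset V} :
    σ ∈ relFaces X A k ↔ σ ∈ X.faces ∧ (σ.card : ℤ) = k + 1 ∧ σ ∉ A.faces := by
  simp only [relFaces, Finset.mem_sdiff, mem_facesOfDim]
  tauto

theorem subset_vertices {X : FinComplex V} {σ : Finset V} (h : σ ∈ X.faces) :
    σ ⊆ X.vertices :=
  Finset.subset_biUnion_of_mem id h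

theorem mem_vertices {X : FinComplex V} {v : V} : v ∈ X.vertices ↔ {v} ∈ X.faces := by
  constructor
  · intro h
    obtain ⟨σ, hσ, hv⟩ := Finset.mem_biUnion.mp h
    exact X.down_closed σ hσ _ (Finset.singleton_subset_iff.mpr hv)
  · intro h
    exact subset_vertices h (Finset.mem_singleton_self v)

theorem exists_missingFace_subset {X : FinComplex V} {σ : Finset V} (hσ : σ ⊆ X.vertices)
    (h : σ ∉ X.faces) : ∃ F ∈ X.missingFaces, F ⊆ σ := by
  induction σ using Finset.strongInduction with
  | H σ ih =>
    by_cases hall : ∀ τ ∈ σ.ssubsets, τ ∈ X.faces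
    · exact ⟨σ, Finset.mem_filter.mpr ⟨Finset.mem_powerset.mpr hσ, h, hall⟩, subset_rfl⟩
    · push Not at hall
      obtain ⟨τ, hτ, hτX⟩ := hall
      have hlt := Finset.mem_ssubsets.mp hτ
      obtain ⟨F, hF, hFτ⟩ := ih τ hlt (hlt.subset.trans hσ) hτX
      exact ⟨F, hF, hFτ.trans hlt.subset⟩

theorem card_le_of_mem_missingFaces {X : FinComplex V} {F : Finset V}
    (hF : F ∈ X.missingFaces) : F.card ≤ X.missingDim + 1 := by
  have : F.card - 1 ≤ X.missingDim :=
    Finset.le_sup (f := fun σ : Finset V => σ.card - 1) hF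
  omega

theorem notMem_faces_of_mem_missingFaces {X : FinComplex V} {F : Finset V}
    (hF : F ∈ X.missingFaces) : F ∉ X.faces :=
  (Finset.mem_filter.mp hF).2.1

theorem degree_eq_card (X : FinComplex V) (σ : Finset V) :
    X.degree σ = ((X.vertices \ σ).filter (fun v => insert v σ ∈ X.faces)).card := by
  symm
  refine Finset.card_bij (fun v _ => insert v σ) ?_ ?_ ?_
  · intro v hv
    simp only [Finset.mem_filter, Finset.mem_sdiff, mem_facesOfDim] at hv ⊢
    refine ⟨⟨hv.2, ?_⟩, Finset.subset_insert _ _⟩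
    rw [Finset.card_insert_of_notMem hv.1.2, dim]
    push_cast
    ring
  · intro a ha b hb hab
    simp only [Finset.mem_filter, Finset.mem_sdiff] at ha hb
    have : a ∈ insert b σ := hab ▸ Finset.mem_insert_self a σ
    exact (Finset.mem_insert.mp this).resolve_right ha.1.2
  · intro τ hτ
    simp only [Finset.mem_filter, mem_facesOfDim, dim] at hτ
    obtain ⟨v, hv, rfl⟩ := (Finset.covBy_iff_exists_insert (s := σ) (t := τ)).mp
      (Finset.covBy_iff_card_sdiff_eq_one.mpr ⟨hτ.2, by
        rw [Finset.card_sdiff_of_subset hτ.2]; omega⟩)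
    refine ⟨v, ?_, rfl⟩
    simp only [Finset.mem_filter, Finset.mem_sdiff]
    exact ⟨⟨subset_vertices hτ.1.1 (Finset.mem_insert_self _ _), hv⟩, hτ.1.1⟩

theorem boundaryCount_eq_card {X A : FinComplex V} {k : ℤ} (hAX : IsSubcomplex A X)
    {σ : Finset V} (hc : (σ.card : ℤ) = k + 1) :
    boundaryCount X A k σ = (σ.filter (fun u => σ.erase u ∈ A.faces)).card := by
  symm
  refine Finset.card_bij (fun u _ => σ.erase u) ?_ ?_ ?_
  · intro u hu
    simp only [Finset.mem_filter, facesIn, Finset.mem_inter, mem_facesOfDim] at hu ⊢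
    have := Finset.card_erase_add_one hu.1
    exact ⟨⟨⟨hAX hu.2, by omega⟩, Finset.erase_subset _ _⟩, hu.2, by omega⟩
  · intro a ha b hb hab
    exact Finset.erase_injOn σ (Finset.mem_filter.mp ha).1 (Finset.mem_filter.mp hb).1 hab
  · intro τ hτ
    simp only [facesIn, Finset.mem_inter, Finset.mem_filter, mem_facesOfDim] at hτ
    obtain ⟨v, hv, rfl⟩ := (Finset.covBy_iff_exists_insert (s := τ) (t := σ)).mp
      (Finset.covBy_iff_card_sdiff_eq_one.mpr ⟨hτ.1.2, by
        rw [Finset.card_sdiff_of_subset hτ.1.2]; omega⟩)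
    refine ⟨v, ?_, Finset.erase_insert hv⟩
    simp only [Finset.mem_filter, Finset.erase_insert hv]
    exact ⟨Finset.mem_insert_self _ _, hτ.2.1⟩

/-- Two distinct cofaces keep a `(k-1)`-face out of a discrete boundary. -/
theorem IsDiscreteBoundary.notMem_of_insert {X A : FinComplex V} {k : ℤ}
    (hA : IsDiscreteBoundary X A k) {η : Finset V} (hc : (η.card : ℤ) = k) {u v : V}
    (huv : u ≠ v) (hu : u ∉ η) (hv : v ∉ η) (hu' : insert u η ∈ X.faces)
    (hv' : insert v η ∈ X.faces) : η ∉ A.faces := by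
  intro hη
  have h := hA.2 η (mem_facesOfDim.mpr ⟨hη, by omega⟩)
  rw [degree_eq_card, Finset.card_le_one] at h
  refine huv (h u ?_ v ?_) <;> simp only [Finset.mem_filter, Finset.mem_sdiff]
  · exact ⟨⟨subset_vertices hu' (Finset.mem_insert_self _ _), hu⟩, hu'⟩
  · exact ⟨⟨subset_vertices hv' (Finset.mem_insert_self _ _), hv⟩, hv'⟩

/-- Deleting some `u ∈ σ` would leave a `(k-1)`-face of `A` with the two cofaces `σ` and `(σ \ {u})
∪ {v}`. The condition `0 ≤ k` provides `u`. -/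
theorem IsDiscreteBoundary.insert_notMem {X A : FinComplex V} {k : ℤ} (hk : 0 ≤ k)
    (hA : IsDiscreteBoundary X A k) {σ : Finset V} (hc : (σ.card : ℤ) = k + 1)
    (hσ : σ ∈ A.faces) {v : V} (hv : v ∉ σ) : insert v σ ∉ X.faces := by
  intro hX
  obtain ⟨u, hu⟩ : σ.Nonempty := Finset.card_pos.mp (by omega)
  have hcard := Finset.card_erase_add_one hu
  refine hA.notMem_of_insert (η := σ.erase u) (by omega) (u := u) (v := v)
    (fun h => hv (h ▸ hu)) (by simp) (by simp [hv]) ?_ ?_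
    (A.down_closed σ hσ _ (Finset.erase_subset _ _))
  · rw [Finset.insert_erase hu]
    exact hA.1 hσ
  · exact X.down_closed _ hX _ (Finset.insert_subset_insert _ (Finset.erase_subset _ _))

theorem IsDiscreteBoundary.notMem_of_ssubset {X A : FinComplex V} {k : ℤ} (hk : 0 ≤ k)
    (hA : IsDiscreteBoundary X A k) {σ τ : Finset V} (hc : (σ.card : ℤ) = k + 1)
    (hτ : τ ∈ X.faces) (hστ : σ ⊂ τ) : σ ∉ A.faces := by
  intro hσ
  obtain ⟨v, hv, hvσ⟩ := Finset.exists_of_ssubset hστ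
  exact hA.insert_notMem hk hc hσ hvσ
    (X.down_closed τ hτ _ (Finset.insert_subset hv hστ.subset))

theorem outerPart_faces_subset (X A : FinComplex V) (k : ℤ) :
    (outerPart X A k).faces ⊆ X.faces :=
  Finset.filter_subset _ _

/-- A `k`-face of `X'` is either a generator or a proper subset of a larger face of `X`; in the
second case discreteness keeps it out of `A`. -/
theorem mem_outerPart_iff_mem_relFaces {X A : FinComplex V} {k : ℤ} (hk : 0 ≤ k)
    (hA : IsDiscreteBoundary X A k) {σ : Finset V} (hc : (σ.card : ℤ) = k + 1) :
    σ ∈ (outerPart X A k).faces ↔ σ ∈ relFaces X A k := by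
  simp only [outerPart, Finset.mem_filter]
  constructor
  · rintro ⟨hX, h | ⟨τ, hτ, h | h, hστ⟩⟩
    · subst h
      simp at hc
      omega
    · have h2 := (mem_relFaces.mp h).2.1
      rwa [Finset.eq_of_subset_of_card_le hστ (by omega)]
    · refine mem_relFaces.mpr ⟨hX, hc, hA.notMem_of_ssubset hk hc hτ ?_⟩
      refine hστ.ssubset_of_ne ?_
      rintro rfl
      simp only [dim] at h
      omega
  · intro h
    exact ⟨(mem_relFaces.mp h).1, Or.inr ⟨σ, (mem_relFaces.mp h).1, Or.inl h, subset_rfl⟩⟩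

theorem facesOfDim_outerPart {X A : FinComplex V} {k : ℤ} (hk : 0 ≤ k)
    (hA : IsDiscreteBoundary X A k) : (outerPart X A k).facesOfDim k = relFaces X A k := by
  ext σ
  rw [mem_facesOfDim]
  constructor
  · rintro ⟨h, hc⟩
    exact (mem_outerPart_iff_mem_relFaces hk hA hc).mp h
  · intro h
    have hc := (mem_relFaces.mp h).2.1
    exact ⟨(mem_outerPart_iff_mem_relFaces hk hA hc).mpr h, hc⟩

theorem mem_relFaces_succ_iff {X A : FinComplex V} {k : ℤ} (hk : 0 ≤ k)
    (hA : IsDiscreteBoundary X A k) {ρ : Finset V} (hc : (ρ.card : ℤ) = k + 2) :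
    ρ ∈ relFaces X A (k + 1) ↔ ρ ∈ (outerPart X A k).faces := by
  rw [mem_relFaces]
  constructor
  · rintro ⟨h, -, -⟩
    exact Finset.mem_filter.mpr ⟨h, Or.inr ⟨ρ, h, Or.inr (by simp only [dim]; omega), subset_rfl⟩⟩
  · intro h
    have hX := outerPart_faces_subset X A k h
    refine ⟨hX, by omega, fun hρ => ?_⟩
    obtain ⟨v, hv⟩ : ρ.Nonempty := Finset.card_pos.mp (by omega)
    have hcard := Finset.card_erase_add_one hv
    exact hA.notMem_of_ssubset hk (by omega) hX (Finset.erase_ssubset hv)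
      (A.down_closed ρ hρ _ (Finset.erase_subset _ _))

/-- The pairs `(v, u)` for which exchanging `u ∈ σ` for the vertex `v ∉ σ` gives a face, although
`σ ∪ {v}` is not one. -/
def swaps (Y : FinComplex V) (σ : Finset V) : Finset (V × V) :=
  ((Y.vertices \ σ) ×ˢ σ).filter
    (fun p => insert p.1 σ ∉ Y.faces ∧ insert p.1 (σ.erase p.2) ∈ Y.faces)

theorem mem_swaps {Y : FinComplex V} {σ : Finset V} {p : V × V} :
    p ∈ Y.swaps σ ↔ (p.1 ∉ σ ∧ p.2 ∈ σ) ∧ insert p.1 σ ∉ Y.faces ∧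
      insert p.1 (σ.erase p.2) ∈ Y.faces := by
  simp only [swaps, Finset.mem_filter, Finset.mem_product, Finset.mem_sdiff]
  constructor
  · tauto
  · rintro ⟨⟨h1, h2⟩, h3, h4⟩
    exact ⟨⟨⟨subset_vertices h4 (Finset.mem_insert_self _ _), h1⟩, h2⟩, h3, h4⟩

/-- A non-face inside `σ ∪ {v}` that avoided `u` would lie in the swapped face. -/
theorem mem_of_mem_swaps {Y : FinComplex V} {σ F : Finset V} {p : V × V} (hp : p ∈ Y.swaps σ)
    (hF : F ∉ Y.faces) (hFσ : F ⊆ insert p.1 σ) : p.2 ∈ F := by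
  by_contra h
  refine hF (Y.down_closed _ (mem_swaps.mp hp).2.2 F fun x hx => ?_)
  rcases Finset.mem_insert.mp (hFσ hx) with rfl | hx'
  · exact Finset.mem_insert_self _ _
  · exact Finset.mem_insert_of_mem (Finset.mem_erase.mpr ⟨fun e => h (e ▸ hx), hx'⟩)

theorem card_swaps_eq (Y : FinComplex V) (σ : Finset V) :
    (Y.swaps σ).card = ∑ v ∈ (Y.vertices \ σ).filter (fun v => insert v σ ∉ Y.faces),
      (σ.filter (fun u => insert v (σ.erase u) ∈ Y.faces)).card := by
  rw [← Finset.card_sigma]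
  refine Finset.card_bij' (fun p _ => ⟨p.1, p.2⟩) (fun p _ => (p.1, p.2)) ?_ ?_ ?_ ?_
  · rintro ⟨v, u⟩ h
    simp only [swaps, Finset.mem_filter, Finset.mem_product, Finset.mem_sigma] at h ⊢
    tauto
  · rintro ⟨v, u⟩ h
    simp only [swaps, Finset.mem_filter, Finset.mem_product, Finset.mem_sigma] at h ⊢
    tauto
  · intros; rfl
  · intros; rfl

theorem exists_missingFace_mem {Y : FinComplex V} {σ : Finset V} (hσ : σ ∈ Y.faces) {v : V}
    (hv : v ∈ Y.vertices) (h : insert v σ ∉ Y.faces) :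
    ∃ F ∈ Y.missingFaces, F ⊆ insert v σ ∧ v ∈ F := by
  obtain ⟨F, hF, hFs⟩ := exists_missingFace_subset
    (Finset.insert_subset hv (subset_vertices hσ)) h
  refine ⟨F, hF, hFs, ?_⟩
  by_contra hvF
  exact notMem_faces_of_mem_missingFaces hF
    (Y.down_closed σ hσ F ((Finset.subset_insert_iff_of_notMem hvF).mp hFs))

/-- All exchangeable `u` lie in `F \ {v}` for a single missing face `F ∋ v` inside `σ ∪ {v}`, and
`F` has at most `h' + 1` elements. -/
theorem card_filter_swap_le {Y : FinComplex V} {σ : Finset V} (hσ : σ ∈ Y.faces) {v : V}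
    (hv : v ∈ Y.vertices) (h : insert v σ ∉ Y.faces) :
    (σ.filter (fun u => insert v (σ.erase u) ∈ Y.faces)).card ≤ Y.missingDim := by
  have hvσ : v ∉ σ := fun hm => h (by rwa [Finset.insert_eq_of_mem hm])
  obtain ⟨F, hF, hFs, hvF⟩ := exists_missingFace_mem hσ hv h
  have hle := card_le_of_mem_missingFaces hF
  have hcard := Finset.card_erase_add_one hvF
  refine (Finset.card_le_card (t := F.erase v) fun u hu => ?_).trans (by omega)
  rw [Finset.mem_filter] at hu
  have huF := mem_of_mem_swaps (p := (v, u)) (mem_swaps.mpr ⟨⟨hvσ, hu.1⟩, h, hu.2⟩)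
    (notMem_faces_of_mem_missingFaces hF) hFs
  exact Finset.mem_erase.mpr ⟨fun e => hvσ (e ▸ hu.1), huF⟩

theorem card_filter_insert_notMem {Y : FinComplex V} {σ : Finset V} (hσ : σ ∈ Y.faces) :
    ((Y.vertices \ σ).filter (fun v => insert v σ ∉ Y.faces)).card + Y.degree σ + σ.card
      = Y.vertices.card := by
  rw [degree_eq_card]
  have h1 := Finset.card_filter_add_card_filter_not (s := Y.vertices \ σ)
    (fun v => insert v σ ∈ Y.faces)
  have h2 := Finset.card_sdiff_add_card_eq_card (subset_vertices hσ)
  omega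

theorem card_swaps_le {Y : FinComplex V} {σ : Finset V} (hσ : σ ∈ Y.faces) :
    ((Y.swaps σ).card : ℤ) ≤
      Y.missingDim * ((Y.vertices.card : ℤ) - σ.card - Y.degree σ) := by
  have h1 : (Y.swaps σ).card ≤
      ((Y.vertices \ σ).filter (fun v => insert v σ ∉ Y.faces)).card * Y.missingDim := by
    rw [card_swaps_eq, ← smul_eq_mul]
    refine Finset.sum_le_card_nsmul _ _ _ fun v hv => ?_
    simp only [Finset.mem_filter, Finset.mem_sdiff] at hv
    exact card_filter_swap_le hσ hv.1.1 hv.2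
  have h2 := card_filter_insert_notMem hσ
  have h3 : (Y.vertices.card : ℤ) - σ.card - Y.degree σ =
      ((Y.vertices \ σ).filter (fun v => insert v σ ∉ Y.faces)).card := by omega
  rw [h3, mul_comm]
  exact_mod_cast h1

end DecEq

/-! ### Orientation signs and incidence sums -/

section Order
variable [LinearOrder V]

/-- The sign with which `v` is inserted into the increasingly ordered set `σ`. -/
def insertSign (v : V) (σ : Finset V) : ℝ := (-1) ^ (σ.filter (fun w => w < v)).card

theorem insertSign_mul_self (v : V) (σ : Finset V) : insertSign v σ * insertSign v σ = 1 := by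
  rw [insertSign, ← mul_pow]
  simp

theorem abs_insertSign (v : V) (σ : Finset V) : |insertSign v σ| = 1 := by
  simp [insertSign, abs_pow]

theorem insertSign_insert {u v : V} {η : Finset V} (hu : u ∉ η) :
    insertSign v (insert u η) = (if u < v then -1 else 1) * insertSign v η := by
  unfold insertSign
  rw [Finset.filter_insert]
  split_ifs with h
  · rw [Finset.card_insert_of_notMem (by simp [hu]), pow_succ]
    ring
  · simp

theorem insertSign_insert_self (v : V) (η : Finset V) :
    insertSign v (insert v η) = insertSign v η := by
  unfold insertSign
  rw [Finset.filter_insert, if_neg (lt_irrefl v)]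

/-- Exactly one of `u < v` and `v < u` holds, so exactly one of the two signs changes. This is the
identity behind `∂∂ = 0`; here it makes the upper and lower parts of the Laplacian cancel. -/
theorem insertSign_anticomm {u v : V} {η : Finset V} (hu : u ∉ η) (hv : v ∉ η) (huv : u ≠ v) :
    insertSign v (insert u η) * insertSign u (insert v η) =
      -(insertSign u η * insertSign v η) := by
  rw [insertSign_insert hu, insertSign_insert hv]
  rcases lt_or_gt_of_ne huv with h | h
  · rw [if_pos h, if_neg h.not_gt]
    ring
  · rw [if_pos h, if_neg h.not_gt]
    ring

theorem incidence_insert {v : V} {η : Finset V} (hv : v ∉ η) :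
    incidence η (insert v η) = insertSign v η := by
  unfold incidence
  rw [Finset.sum_eq_single v]
  · rw [if_pos (Finset.erase_insert hv).symm]
    exact insertSign_insert_self v η
  · intro w hw hwv
    refine if_neg fun h => hv ?_
    rw [h]
    exact Finset.mem_erase.mpr ⟨hwv.symm, Finset.mem_insert_self _ _⟩
  · intro h
    exact absurd (Finset.mem_insert_self _ _) h

theorem incidence_erase {u : V} {σ : Finset V} (hu : u ∈ σ) :
    incidence (σ.erase u) σ = insertSign u (σ.erase u) := by
  conv_lhs => rw [← Finset.insert_erase hu, Finset.erase_insert (Finset.notMem_erase u σ)]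
  exact incidence_insert (Finset.notMem_erase u σ)

theorem exists_of_incidence_ne_zero {η σ : Finset V} (h : incidence η σ ≠ 0) :
    ∃ u ∈ σ, η = σ.erase u := by
  by_contra hn
  push Not at hn
  exact h (Finset.sum_eq_zero fun v hv => if_neg (hn v hv))

theorem sum_incidence_mul_eq_sum_insert (S : Finset (Finset V)) (U η : Finset V)
    (hU : ∀ τ ∈ S, τ ⊆ U) (f : Finset V → ℝ) :
    ∑ τ ∈ S, incidence η τ * f τ =
      ∑ v ∈ (U \ η).filter (fun v => insert v η ∈ S), insertSign v η * f (insert v η) := by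
  symm
  refine Finset.sum_of_injOn (fun v => insert v η) ?_ ?_ ?_ ?_
  · intro a ha b hb hab
    simp only [Finset.coe_filter, Finset.mem_sdiff, Set.mem_ofPred_eq] at ha hb
    have hab' : insert a η = insert b η := hab
    have : a ∈ insert b η := hab' ▸ Finset.mem_insert_self a η
    exact (Finset.mem_insert.mp this).resolve_right ha.1.2
  · intro v hv
    exact (Finset.mem_filter.mp hv).2
  · intro τ hτ hnot
    by_contra hne
    obtain ⟨u, hu, rfl⟩ := exists_of_incidence_ne_zero (left_ne_zero_of_mul hne)
    refine hnot ⟨u, ?_, Finset.insert_erase hu⟩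
    simp only [Finset.coe_filter, Finset.mem_sdiff, Set.mem_ofPred_eq, Finset.insert_erase hu]
    exact ⟨⟨hU τ hτ hu, Finset.notMem_erase _ _⟩, hτ⟩
  · intro v hv
    simp only [Finset.mem_filter, Finset.mem_sdiff] at hv
    rw [incidence_insert hv.1.2]

theorem sum_incidence_mul_eq_sum_erase (S : Finset (Finset V)) (σ : Finset V)
    (f : Finset V → ℝ) :
    ∑ η ∈ S, incidence η σ * f η =
      ∑ u ∈ σ.filter (fun u => σ.erase u ∈ S), insertSign u (σ.erase u) * f (σ.erase u) := by
  symm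
  refine Finset.sum_of_injOn (fun u => σ.erase u) ?_ ?_ ?_ ?_
  · intro a ha b hb hab
    exact Finset.erase_injOn σ (Finset.mem_filter.mp ha).1 (Finset.mem_filter.mp hb).1 hab
  · intro v hv
    exact (Finset.mem_filter.mp hv).2
  · intro τ hτ hnot
    by_contra hne
    obtain ⟨u, hu, rfl⟩ := exists_of_incidence_ne_zero (left_ne_zero_of_mul hne)
    exact hnot ⟨u, Finset.mem_filter.mpr ⟨hu, hτ⟩, rfl⟩
  · intro u hu
    rw [incidence_erase (Finset.mem_filter.mp hu).1]

end Order
end FinComplex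

/-! ### The Laplacian in terms of swaps -/

namespace FinComplex

variable {V : Type*} [LinearOrder V]

/-- The summand of the Laplacian `L_k z (σ)` that comes from exchanging `u ∈ σ` for `v ∉ σ`. -/
def swapTerm (z : Finset V → ℝ) (σ : Finset V) (v u : V) : ℝ :=
  insertSign u (σ.erase u) * insertSign v (σ.erase u) * z (insert v (σ.erase u))

theorem abs_swapTerm (z : Finset V → ℝ) (σ : Finset V) (v u : V) :
    |swapTerm z σ v u| = |z (insert v (σ.erase u))| := by
  rw [swapTerm, abs_mul, abs_mul, abs_insertSign, abs_insertSign, one_mul, one_mul]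

theorem sum_swaps_eq (Y : FinComplex V) (σ : Finset V) (f : V → V → ℝ) :
    ∑ p ∈ Y.swaps σ, f p.1 p.2 = ∑ v ∈ Y.vertices \ σ, ∑ u ∈ σ,
      if insert v σ ∉ Y.faces ∧ insert v (σ.erase u) ∈ Y.faces then f v u else 0 := by
  rw [swaps, Finset.sum_filter, Finset.sum_product]

theorem relLaplacian_mulVec_eq (X A : FinComplex V) (k : ℤ) (z : Finset V → ℝ)
    (σ : relFaces X A k) :
    (relLaplacian X A k).mulVec (fun τ => z τ.1) σ =
      ∑ ρ ∈ relFaces X A (k + 1), incidence σ.1 ρ *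
          ∑ τ ∈ relFaces X A k, incidence τ ρ * z τ +
        ∑ η ∈ relFaces X A (k - 1), incidence η σ.1 *
          ∑ τ ∈ relFaces X A k, incidence η τ * z τ := by
  rw [relLaplacian, Matrix.add_mulVec, ← Matrix.mulVec_mulVec, ← Matrix.mulVec_mulVec,
    Pi.add_apply]
  simp only [Matrix.mulVec, dotProduct, Matrix.transpose_apply, relBoundary, Matrix.of_apply]
  congr 1
  · rw [← Finset.sum_coe_sort (relFaces X A (k + 1))]
    refine Finset.sum_congr rfl fun ρ _ => ?_
    rw [← Finset.sum_coe_sort (relFaces X A k)]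
  · rw [← Finset.sum_coe_sort (relFaces X A (k - 1))]
    refine Finset.sum_congr rfl fun η _ => ?_
    rw [← Finset.sum_coe_sort (relFaces X A k)]

section
variable {X A : FinComplex V} {k : ℤ}

theorem up_part_eq (hk : 0 ≤ k) (hA : IsDiscreteBoundary X A k)
    (z : Finset V → ℝ) {σ : Finset V} (hσ : σ ∈ relFaces X A k) :
    ∑ ρ ∈ relFaces X A (k + 1), incidence σ ρ *
        ∑ τ ∈ relFaces X A k, incidence τ ρ * z τ =
      ∑ v ∈ (outerPart X A k).vertices \ σ,
        if insert v σ ∈ (outerPart X A k).faces then z σ - ∑ u ∈ σ, swapTerm z σ v u else 0 := by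
  have hc := (mem_relFaces.mp hσ).2.1
  rw [sum_incidence_mul_eq_sum_insert _ (outerPart X A k).vertices]
  · rw [Finset.sum_filter]
    refine Finset.sum_congr rfl fun v hv => ?_
    have hvσ := (Finset.mem_sdiff.mp hv).2
    have hcv : ((insert v σ).card : ℤ) = k + 2 := by
      rw [Finset.card_insert_of_notMem hvσ]
      push_cast
      omega
    by_cases hY : insert v σ ∈ (outerPart X A k).faces
    · rw [if_pos hY, if_pos ((mem_relFaces_succ_iff hk hA hcv).mpr hY),
        sum_incidence_mul_eq_sum_erase, Finset.filter_true_of_mem, Finset.sum_insert hvσ,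
        Finset.erase_insert hvσ, mul_add, ← mul_assoc, insertSign_mul_self, one_mul,
        sub_eq_add_neg, Finset.mul_sum, ← Finset.sum_neg_distrib]
      · congr 1
        refine Finset.sum_congr rfl fun u hu => ?_
        have huv : v ≠ u := fun e => hvσ (e ▸ hu)
        have h := insertSign_anticomm (Finset.notMem_erase u σ)
          (v := v) (fun h => hvσ (Finset.mem_of_mem_erase h)) huv.symm
        rw [Finset.insert_erase hu] at h
        rw [Finset.erase_insert_of_ne huv, swapTerm]
        linear_combination z (insert v (σ.erase u)) * h
      · intro u hu
        have hcu := Finset.card_erase_add_one hu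
        exact (mem_outerPart_iff_mem_relFaces hk hA (by omega)).mp
          (FinComplex.down_closed _ _ hY _ (Finset.erase_subset _ _))
    · rw [if_neg hY, if_neg fun h => hY ((mem_relFaces_succ_iff hk hA hcv).mp h)]
  · intro τ hτ
    have hc' := (mem_relFaces.mp hτ).2.1
    exact subset_vertices ((mem_relFaces_succ_iff hk hA (by omega)).mp hτ)

theorem down_part_eq (hk : 0 ≤ k) (hA : IsDiscreteBoundary X A k)
    (z : Finset V → ℝ) {σ : Finset V} (hσ : σ ∈ relFaces X A k) :
    ∑ η ∈ relFaces X A (k - 1), incidence η σ *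
        ∑ τ ∈ relFaces X A k, incidence η τ * z τ =
      (k + 1 - boundaryCount X A k σ) * z σ +
      ∑ v ∈ (outerPart X A k).vertices \ σ, ∑ u ∈ σ,
        if insert v (σ.erase u) ∈ (outerPart X A k).faces then swapTerm z σ v u else 0 := by
  have hc := (mem_relFaces.mp hσ).2.1
  have hσX := (mem_relFaces.mp hσ).1
  have hU : ∀ τ ∈ relFaces X A k, τ ⊆ (outerPart X A k).vertices := fun τ hτ =>
    subset_vertices ((mem_outerPart_iff_mem_relFaces hk hA (mem_relFaces.mp hτ).2.1).mpr hτ)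
  have hinner : ∀ u ∈ σ, (if σ.erase u ∈ relFaces X A (k - 1) then
      insertSign u (σ.erase u) * ∑ τ ∈ relFaces X A k, incidence (σ.erase u) τ * z τ else 0) =
      (if σ.erase u ∈ A.faces then 0 else z σ) + ∑ v ∈ (outerPart X A k).vertices \ σ,
        if insert v (σ.erase u) ∈ (outerPart X A k).faces then swapTerm z σ v u else 0 := by
    intro u hu
    have hcu := Finset.card_erase_add_one hu
    have hmem : σ.erase u ∈ relFaces X A (k - 1) ↔ σ.erase u ∉ A.faces := by
      rw [mem_relFaces]
      exact ⟨fun h => h.2.2, fun h =>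
        ⟨X.down_closed σ hσX _ (Finset.erase_subset _ _), by omega, h⟩⟩
    by_cases huA : σ.erase u ∈ A.faces
    · rw [if_neg fun h => hmem.mp h huA, if_pos huA, zero_add]
      -- No swap through a face `σ \ {u}` of `A` exists, as it would have a second coface; so the
      -- sum over `v` may be kept without mentioning `A`.
      symm
      refine Finset.sum_eq_zero fun v hv => if_neg fun hY => ?_
      have hvσ := (Finset.mem_sdiff.mp hv).2
      refine hA.notMem_of_insert (η := σ.erase u) (by omega) (u := u) (v := v)
        (fun e => hvσ (e ▸ hu)) (by simp) (by simp [hvσ]) ?_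
        (outerPart_faces_subset X A k hY) huA
      rwa [Finset.insert_erase hu]
    · rw [if_pos (hmem.mpr huA), if_neg huA, sum_incidence_mul_eq_sum_insert _ _ _ hU,
        Finset.sdiff_erase (hU σ hσ hu), Finset.sum_filter, Finset.sum_insert (by simp [hu]),
        Finset.insert_erase hu, if_pos hσ, mul_add, ← mul_assoc, insertSign_mul_self, one_mul,
        Finset.mul_sum]
      congr 1
      refine Finset.sum_congr rfl fun v hv => ?_
      have hvσ := (Finset.mem_sdiff.mp hv).2
      have hcv : ((insert v (σ.erase u)).card : ℤ) = k + 1 := by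
        rw [Finset.card_insert_of_notMem (by simp [hvσ])]
        push_cast
        omega
      have hiff := mem_outerPart_iff_mem_relFaces hk hA hcv
      by_cases h : insert v (σ.erase u) ∈ relFaces X A k
      · rw [if_pos h, if_pos (hiff.mpr h), swapTerm, mul_assoc]
      · rw [if_neg h, if_neg fun h' => h (hiff.mp h'), mul_zero]
  rw [sum_incidence_mul_eq_sum_erase, Finset.sum_filter, Finset.sum_congr rfl hinner,
    Finset.sum_add_distrib, Finset.sum_comm]
  congr 1
  have h0 : ∀ u ∈ σ, (if σ.erase u ∈ A.faces then 0 else z σ) =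
      z σ - if σ.erase u ∈ A.faces then z σ else 0 := by
    intro u _
    split_ifs <;> simp
  have hc' : (σ.card : ℝ) = k + 1 := by exact_mod_cast hc
  rw [Finset.sum_congr rfl h0, Finset.sum_sub_distrib, ← Finset.sum_filter, Finset.sum_const,
    Finset.sum_const, boundaryCount_eq_card hA.1 hc, nsmul_eq_mul, nsmul_eq_mul, hc']
  ring

/-- For a vertex `v` with `σ ∪ {v}` a face, all `σ ∪ {v} \ {u}` are faces, and the terms of the
upper and lower parts cancel, leaving one `z σ` that counts towards the degree. For the other `v`
only the lower part contributes. -/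
theorem relLaplacian_mulVec (hk : 0 ≤ k) (hA : IsDiscreteBoundary X A k)
    (z : Finset V → ℝ) (σ : relFaces X A k) :
    (relLaplacian X A k).mulVec (fun τ => z τ.1) σ =
      (k + 1 + (outerPart X A k).degree σ.1 - boundaryCount X A k σ.1) * z σ.1 +
        ∑ p ∈ (outerPart X A k).swaps σ.1, swapTerm z σ.1 p.1 p.2 := by
  rw [relLaplacian_mulVec_eq, up_part_eq hk hA z σ.2, down_part_eq hk hA z σ.2, sum_swaps_eq,
    degree_eq_card]
  have h1 : ∀ v ∈ (outerPart X A k).vertices \ σ.1,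
      ((if insert v σ.1 ∈ (outerPart X A k).faces then z σ.1 - ∑ u ∈ σ.1, swapTerm z σ.1 v u
        else 0) + ∑ u ∈ σ.1,
        if insert v (σ.1.erase u) ∈ (outerPart X A k).faces then swapTerm z σ.1 v u else 0) =
      (if insert v σ.1 ∈ (outerPart X A k).faces then z σ.1 else 0) + ∑ u ∈ σ.1,
        if insert v σ.1 ∉ (outerPart X A k).faces ∧
          insert v (σ.1.erase u) ∈ (outerPart X A k).faces then swapTerm z σ.1 v u else 0 := by
    intro v _
    by_cases h : insert v σ.1 ∈ (outerPart X A k).faces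
    · have h' : ∀ u, insert v (σ.1.erase u) ∈ (outerPart X A k).faces := fun u =>
        FinComplex.down_closed _ _ h _ (Finset.insert_subset_insert _ (Finset.erase_subset _ _))
      simp [h, h']
    · simp [h]
  have h2 := Finset.sum_congr rfl h1
  rw [Finset.sum_add_distrib, Finset.sum_add_distrib] at h2
  have h3 : (∑ v ∈ (outerPart X A k).vertices \ σ.1,
      if insert v σ.1 ∈ (outerPart X A k).faces then z σ.1 else 0) =
      (((outerPart X A k).vertices \ σ.1).filter
        (fun v => insert v σ.1 ∈ (outerPart X A k).faces)).card * z σ.1 := by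
    rw [← Finset.sum_filter, Finset.sum_const, nsmul_eq_mul]
  rw [h3] at h2
  linear_combination h2

end
end FinComplex

/-! ### Rigidity: joins of boundaries of simplices -/

namespace FinComplex

variable {V : Type*} 

section DecEq
variable [DecidableEq V]

/-- `Y` is the join of the boundaries of `r` simplices of dimension `h`, with disjoint vertex sets
`P i`, and of the full simplex on the other vertices. -/
def IsBoundaryJoin (Y : FinComplex V) (h r : ℕ) : Prop :=
  ∃ P : Fin r → Finset V, (∀ i, P i ⊆ Y.vertices) ∧ (∀ i, (P i).card = h + 1) ∧
    (∀ i j, i ≠ j → Disjoint (P i) (P j)) ∧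
    ∀ τ, τ ∈ Y.faces ↔ τ ⊆ Y.vertices ∧ ∀ i, ¬ P i ⊆ τ

theorem IsBoundaryJoin.card_mul_le {Y : FinComplex V} {h r : ℕ} (hY : Y.IsBoundaryJoin h r) :
    r * (h + 1) ≤ Y.vertices.card := by
  obtain ⟨P, hP, hc, hd, -⟩ := hY
  have h1 : (Finset.univ.biUnion P).card = ∑ i, (P i).card :=
    Finset.card_biUnion fun i _ j _ hij => hd i j hij
  have h2 : (Finset.univ.biUnion P).card ≤ Y.vertices.card :=
    Finset.card_le_card (Finset.biUnion_subset.mpr fun i _ => hP i)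
  simpa [hc, h1] using h2

/-- A family `T` of faces without cofaces, closed under swaps, for which every vertex outside a
face allows the maximal number of swaps and swaps for different vertices use different elements,
makes the complex a join of boundaries of simplices. -/
theorem isBoundaryJoin_of_swaps {Y : FinComplex V} {c : ℕ} {T : Set (Finset V)}
    (hTY : ∀ σ ∈ T, σ ∈ Y.faces ∧ σ.card = c)
    (hT1 : ∀ σ ∈ T, ∀ v ∈ Y.vertices \ σ, insert v σ ∉ Y.faces ∧
      (σ.filter (fun u => insert v (σ.erase u) ∈ Y.faces)).card = Y.missingDim)
    (hT2 : ∀ σ ∈ T, ∀ p ∈ Y.swaps σ, insert p.1 (σ.erase p.2) ∈ T)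
    (hT3 : ∀ σ ∈ T, ∀ u v v', (v, u) ∈ Y.swaps σ → (v', u) ∈ Y.swaps σ → v = v')
    {σ₀ : Finset V} (hσ₀ : σ₀ ∈ T) :
    Y.IsBoundaryJoin Y.missingDim (Y.vertices.card - c) ∧
      ∀ τ ∈ Y.faces, τ.card = c → τ ∈ T := by
  set W := Y.vertices with hW
  set U : Finset V → V → Finset V :=
    fun σ v => σ.filter (fun u => insert v (σ.erase u) ∈ Y.faces) with hU
  have hUsub : ∀ σ ∈ T, ∀ v ∈ W \ σ, ∀ G ⊆ insert v σ, G ∉ Y.faces → U σ v ⊆ G.erase v := by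
    intro σ hσ v hv G hG hGY u hu
    have hvσ := (Finset.mem_sdiff.mp hv).2
    rw [hU, Finset.mem_filter] at hu
    have := mem_of_mem_swaps (p := (v, u)) (mem_swaps.mpr ⟨⟨hvσ, hu.1⟩, (hT1 σ hσ v hv).1, hu.2⟩)
      hGY hG
    exact Finset.mem_erase.mpr ⟨fun e => hvσ (e ▸ hu.1), this⟩
  -- A non-face through `v` of at most `h' + 1` elements has no room for more than `v` and its `h'`
  -- exchangeable elements. This identifies the missing face at `σ₀` and, later, recognises the same
  -- block at other members of `T`.
  have hUeq : ∀ σ ∈ T, ∀ v ∈ W \ σ, ∀ G ⊆ insert v σ, G ∉ Y.faces → v ∈ G →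
      G.card ≤ Y.missingDim + 1 → G.erase v = U σ v := by
    intro σ hσ v hv G hG hGY hvG hGc
    have h1 := Finset.card_erase_add_one hvG
    refine (Finset.eq_of_subset_of_card_le (hUsub σ hσ v hv G hG hGY) ?_).symm
    have := (hT1 σ hσ v hv).2
    simp only [hU]
    omega
  set F : V → Finset V := fun v => insert v (U σ₀ v) with hF
  have hvF : ∀ v, v ∈ F v := fun v => Finset.mem_insert_self _ _
  have hUσ : ∀ v, U σ₀ v ⊆ σ₀ := fun v => Finset.filter_subset _ _
  have hFmem : ∀ v ∈ W \ σ₀, F v ∈ Y.missingFaces := by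
    intro v hv
    have hv' := Finset.mem_sdiff.mp hv
    obtain ⟨G, hG, hGs, hvG⟩ := exists_missingFace_mem (hTY σ₀ hσ₀).1 hv'.1 (hT1 σ₀ hσ₀ v hv).1
    have := hUeq σ₀ hσ₀ v hv G hGs (notMem_faces_of_mem_missingFaces hG) hvG
      (card_le_of_mem_missingFaces hG)
    rw [hF]
    simp only
    rwa [← this, Finset.insert_erase hvG]
  have hFn : ∀ v ∈ W \ σ₀, F v ∉ Y.faces := fun v hv =>
    notMem_faces_of_mem_missingFaces (hFmem v hv)
  have hFW : ∀ v ∈ W \ σ₀, F v ⊆ W := fun v hv =>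
    Finset.insert_subset (Finset.mem_sdiff.mp hv).1
      ((hUσ v).trans (subset_vertices (hTY σ₀ hσ₀).1))
  have hFc : ∀ v ∈ W \ σ₀, (F v).card = Y.missingDim + 1 := by
    intro v hv
    rw [hF, Finset.card_insert_of_notMem fun h => (Finset.mem_sdiff.mp hv).2 (hUσ v h)]
    exact congrArg (· + 1) (hT1 σ₀ hσ₀ v hv).2
  have hFd : ∀ v ∈ W \ σ₀, ∀ w ∈ W \ σ₀, ∀ x, x ∈ F v → x ∈ F w → v = w := by
    intro v hv w hw x hxv hxw
    have hv' := (Finset.mem_sdiff.mp hv).2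
    have hw' := (Finset.mem_sdiff.mp hw).2
    rcases Finset.mem_insert.mp hxv with rfl | hxv <;>
      rcases Finset.mem_insert.mp hxw with h | hxw
    · exact h
    · exact absurd (hUσ w hxw) hv'
    · subst h
      exact absurd (hUσ v hxv) hw'
    · rw [hU, Finset.mem_filter] at hxv hxw
      exact hT3 σ₀ hσ₀ x v w
        (mem_swaps.mpr ⟨⟨hv', hxv.1⟩, (hT1 σ₀ hσ₀ v hv).1, hxv.2⟩)
        (mem_swaps.mpr ⟨⟨hw', hxw.1⟩, (hT1 σ₀ hσ₀ w hw).1, hxw.2⟩)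
  -- Complements of transversals of the blocks `F v` are reached from `σ₀` by swaps, one block at a
  -- time; `S` is the set of blocks already treated. As the blocks are disjoint, treating one leaves
  -- the others untouched.
  have htrans : ∀ f : V → V, (∀ v ∈ W \ σ₀, f v ∈ F v) → ∀ S ⊆ W \ σ₀,
      W \ (W \ σ₀).image (fun v => if v ∈ S then f v else v) ∈ T := by
    intro f hf S
    induction S using Finset.induction_on with
    | empty =>
      intro _
      have hW₀ : W \ (W \ σ₀) = σ₀ :=
        Finset.sdiff_sdiff_eq_self (subset_vertices (hTY σ₀ hσ₀).1)
      simpa only [Finset.notMem_empty, if_false, Finset.image_id', hW₀] using hσ₀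
    | insert v S hvS ih =>
      intro hS
      have hv : v ∈ W \ σ₀ := hS (Finset.mem_insert_self _ _)
      have hσ := ih ((Finset.subset_insert _ _).trans hS)
      set fS : V → V := fun v => if v ∈ S then f v else v with hfS
      have hfSv : fS v = v := if_neg hvS
      have hfSF : ∀ w ∈ W \ σ₀, fS w ∈ F w := by
        intro w hw
        simp only [hfS]
        split_ifs
        exacts [hf w hw, hvF w]
      have hmem : ∀ x, x ∈ W \ (W \ σ₀).image fS ↔ x ∈ W ∧ ∀ w ∈ W \ σ₀, fS w ≠ x := by
        intro x
        simp only [Finset.mem_sdiff, Finset.mem_image, not_exists, not_and, ne_eq]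
      by_cases hfv : f v = v
      · have : (fun w => if w ∈ insert v S then f w else w) = fS := by
          funext w
          by_cases hwv : w = v
          · subst hwv
            simp [hfSv, hfv]
          · simp [hfS, hwv]
        rwa [this]
      · set σ := W \ (W \ σ₀).image fS with hσdef
        have hvσ : v ∈ W \ σ := by
          rw [Finset.mem_sdiff, hmem]
          exact ⟨(Finset.mem_sdiff.mp hv).1, fun h => h.2 v hv hfSv⟩
        have hFσ : F v ⊆ insert v σ := by
          intro x hx
          by_cases hxv : x = v
          · exact hxv ▸ Finset.mem_insert_self _ _
          · refine Finset.mem_insert_of_mem ((hmem x).mpr ⟨hFW v hv hx, fun w hw e => ?_⟩)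
            have := hFd v hv w hw x hx (e ▸ hfSF w hw)
            subst this
            exact hxv (e.symm.trans hfSv)
        have hfU : f v ∈ U σ v := by
          rw [← hUeq σ hσ v hvσ (F v) hFσ (hFn v hv) (hvF v) (hFc v hv).le]
          exact Finset.mem_erase.mpr ⟨hfv, hf v hv⟩
        rw [hU, Finset.mem_filter] at hfU
        have hnew := hT2 σ hσ (v, f v) (mem_swaps.mpr
          ⟨⟨(Finset.mem_sdiff.mp hvσ).2, hfU.1⟩, (hT1 σ hσ v hvσ).1, hfU.2⟩)
        convert hnew using 1
        ext x
        simp only [Finset.mem_insert, Finset.mem_erase, hmem]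
        rw [Finset.mem_sdiff, Finset.mem_image]
        simp only [not_exists, not_and]
        have hother : ∀ w, w ≠ v → (if w = v ∨ w ∈ S then f w else w) = fS w := by
          intro w hw
          simp [hfS, hw]
        constructor
        · rintro ⟨hx, hall⟩
          by_cases hxv : x = v
          · exact Or.inl hxv
          · refine Or.inr ⟨fun e => hall v hv (by simp [e]), hx, fun w hw => ?_⟩
            by_cases hwv : w = v
            · subst hwv
              rw [hfSv]
              exact Ne.symm hxv
            · have := hall w hw
              rwa [hother w hwv] at this
        · rintro (rfl | ⟨hxf, hx, hall⟩)
          · refine ⟨(Finset.mem_sdiff.mp hv).1, fun w hw => ?_⟩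
            by_cases hwv : w = x
            · subst hwv
              simpa using hfv
            · rw [hother w hwv]
              intro e
              exact hwv (hFd x hv w hw x (hvF x) (e ▸ hfSF w hw)).symm
          · refine ⟨hx, fun w hw => ?_⟩
            by_cases hwv : w = v
            · subst hwv
              simpa using Ne.symm hxf
            · rw [hother w hwv]
              exact hall w hw
  -- A set containing no block misses a point `f v` of each, so it lies in the complement of that
  -- transversal.
  have hsup : ∀ τ ⊆ W, (∀ v ∈ W \ σ₀, ¬ F v ⊆ τ) → ∃ ρ ∈ T, τ ⊆ ρ := by
    intro τ hτ hall
    have hex : ∀ v, ∃ x, v ∈ W \ σ₀ → x ∈ F v ∧ x ∉ τ := by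
      intro v
      by_cases hv : v ∈ W \ σ₀
      · obtain ⟨x, hx⟩ := Finset.not_subset.mp (hall v hv)
        exact ⟨x, fun _ => hx⟩
      · exact ⟨v, fun h => absurd h hv⟩
    choose f hf using hex
    refine ⟨_, htrans f (fun v hv => (hf v hv).1) (W \ σ₀) subset_rfl, fun x hx => ?_⟩
    rw [Finset.mem_sdiff, Finset.mem_image]
    refine ⟨hτ hx, ?_⟩
    rintro ⟨v, hv, hvx⟩
    rw [if_pos hv] at hvx
    exact (hf v hv).2 (hvx ▸ hx)
  have hfaces : ∀ τ, τ ∈ Y.faces ↔ τ ⊆ W ∧ ∀ v ∈ W \ σ₀, ¬ F v ⊆ τ := by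
    intro τ
    constructor
    · exact fun h => ⟨subset_vertices h, fun v hv hs => hFn v hv (Y.down_closed τ h _ hs)⟩
    · rintro ⟨h1, h2⟩
      obtain ⟨ρ, hρ, hτρ⟩ := hsup τ h1 h2
      exact Y.down_closed ρ (hTY ρ hρ).1 τ hτρ
  constructor
  · have hcard : (W \ σ₀).card = W.card - c := by
      rw [Finset.card_sdiff_of_subset (subset_vertices (hTY σ₀ hσ₀).1), (hTY σ₀ hσ₀).2]
    let e : Fin (W.card - c) ≃ (W \ σ₀ : Finset V) := (Finset.equivFinOfCardEq hcard).symm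
    refine ⟨fun i => F (e i), fun i => hFW _ (e i).2, fun i => hFc _ (e i).2, ?_, ?_⟩
    · intro i j hij
      rw [Finset.disjoint_left]
      intro x hxi hxj
      exact hij (e.injective (Subtype.ext (hFd _ (e i).2 _ (e j).2 x hxi hxj)))
    · intro τ
      rw [hfaces τ]
      refine and_congr_right fun _ => ⟨fun h i => h _ (e i).2, fun h v hv => ?_⟩
      simpa using h (e.symm ⟨v, hv⟩)
  · intro τ hτ hc
    obtain ⟨ρ, hρ, hτρ⟩ := hsup τ (subset_vertices hτ) ((hfaces τ).mp hτ).2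
    rwa [Finset.eq_of_subset_of_card_le hτρ (by rw [(hTY ρ hρ).2, hc])]

end DecEq

/-! ### Eigenvectors at a face of maximal modulus -/

section Order
variable [LinearOrder V]

theorem exists_eigenvector_max {X A : FinComplex V} {k : ℤ} (hne : (relFaces X A k).Nonempty) :
    ∃ z : Finset V → ℝ, (∀ σ : relFaces X A k,
      (relLaplacian X A k).mulVec (fun τ => z τ.1) σ = spectralGap X A k * z σ.1) ∧
      ∃ σ₀ ∈ relFaces X A k, z σ₀ ≠ 0 ∧ ∀ τ ∈ relFaces X A k, |z τ| ≤ |z σ₀| := by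
  obtain ⟨x, hx⟩ := (spectralGap_isLeast X A k hne).1.exists_hasEigenvector
  have hmem := hx.apply_eq_smul
  rw [Matrix.toLin'_apply] at hmem
  -- Extension by zero to all finite sets, so that `z` can be evaluated at swapped sets without
  -- membership proofs.
  let z : Finset V → ℝ := fun τ => if h : τ ∈ relFaces X A k then x ⟨τ, h⟩ else 0
  have hz : (fun τ : relFaces X A k => z τ.1) = x := by
    funext τ
    simp [z, τ.2]
  refine ⟨z, fun σ => ?_, ?_⟩
  · rw [hz, hmem, ← hz]
    rfl
  · obtain ⟨σ₀, hσ₀, hmax⟩ := Finset.exists_max_image (relFaces X A k) (fun τ => |z τ|) hne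
    refine ⟨σ₀, hσ₀, fun h0 => hx.2 ?_, hmax⟩
    rw [← hz]
    funext τ
    have := hmax τ.1 τ.2
    rw [h0, abs_zero] at this
    exact abs_nonpos_iff.mp this

/-- The eigenvalue equation multiplied by `z σ`. The right-hand side collects the slack of
Gershgorin's estimate, one summand per swap, and each summand is nonnegative when `|z σ|` is
maximal. -/
theorem eigenvector_mul_sq_eq {X A : FinComplex V} {k : ℤ} (hk : 0 ≤ k)
    (hA : IsDiscreteBoundary X A k) {z : Finset V → ℝ} {μ : ℝ} {σ : Finset V}
    (hσ : σ ∈ relFaces X A k)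
    (hz : (relLaplacian X A k).mulVec (fun τ => z τ.1) ⟨σ, hσ⟩ = μ * z σ) :
    (μ - (k + 1 + (outerPart X A k).degree σ - boundaryCount X A k σ -
      ((outerPart X A k).swaps σ).card)) * z σ ^ 2 =
      ∑ p ∈ (outerPart X A k).swaps σ, (z σ ^ 2 + z σ * swapTerm z σ p.1 p.2) := by
  rw [relLaplacian_mulVec hk hA] at hz
  rw [Finset.sum_add_distrib, ← Finset.mul_sum, Finset.sum_const, nsmul_eq_mul]
  linear_combination (-z σ) * hz

theorem sq_add_mul_swapTerm_nonneg {z : Finset V → ℝ} {σ : Finset V}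
    {p : V × V} (hmax : |z (insert p.1 (σ.erase p.2))| ≤ |z σ|) :
    0 ≤ z σ ^ 2 + z σ * swapTerm z σ p.1 p.2 := by
  rw [← abs_swapTerm] at hmax
  have h1 : |z σ * swapTerm z σ p.1 p.2| ≤ |z σ| * |z σ| := by
    rw [abs_mul]
    exact mul_le_mul_of_nonneg_left hmax (abs_nonneg _)
  have h2 := neg_abs_le (z σ * swapTerm z σ p.1 p.2)
  rw [abs_mul_abs_self] at h1
  nlinarith

end Order
end FinComplex

/-! ### Gershgorin bound and its equality case -/

namespace FinComplex

variable {V : Type*} [LinearOrder V]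

theorem mem_relFaces_of_mem_swaps {X A : FinComplex V} {k : ℤ} (hk : 0 ≤ k)
    (hA : IsDiscreteBoundary X A k) {σ : Finset V} (hσ : σ ∈ relFaces X A k) {p : V × V}
    (hp : p ∈ (outerPart X A k).swaps σ) : insert p.1 (σ.erase p.2) ∈ relFaces X A k := by
  have hc := (mem_relFaces.mp hσ).2.1
  obtain ⟨⟨h1, h2⟩, -, h4⟩ := mem_swaps.mp hp
  have hcu := Finset.card_erase_add_one h2
  refine (mem_outerPart_iff_mem_relFaces hk hA ?_).mp h4
  rw [Finset.card_insert_of_notMem fun h => h1 (Finset.mem_of_mem_erase h)]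
  omega

/-- The Gershgorin bound for the relative Laplacian. -/
theorem exists_le_spectralGap {X A : FinComplex V} {k : ℤ} (hk : 0 ≤ k)
    (hA : IsDiscreteBoundary X A k) (hne : (relFaces X A k).Nonempty) :
    ∃ σ ∈ relFaces X A k,
      (((((outerPart X A k).missingDim : ℤ) + 1) * (outerPart X A k).degree σ -
        boundaryCount X A k σ + (((outerPart X A k).missingDim + 1) * (k + 1) -
        (outerPart X A k).missingDim * (outerPart X A k).vertices.card) : ℤ) : ℝ) ≤
      spectralGap X A k := by
  obtain ⟨z, hz, σ, hσ, h0, hmax⟩ := exists_eigenvector_max hne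
  refine ⟨σ, hσ, ?_⟩
  have hc := (mem_relFaces.mp hσ).2.1
  have hY := (mem_outerPart_iff_mem_relFaces hk hA hc).mpr hσ
  have heq := eigenvector_mul_sq_eq hk hA hσ (hz ⟨σ, hσ⟩)
  have hnn : 0 ≤ ∑ p ∈ (outerPart X A k).swaps σ, (z σ ^ 2 + z σ * swapTerm z σ p.1 p.2) :=
    Finset.sum_nonneg fun p hp =>
      sq_add_mul_swapTerm_nonneg (hmax _ (mem_relFaces_of_mem_swaps hk hA hσ hp))
  rw [← heq] at hnn
  have hle := nonneg_of_mul_nonneg_left hnn (by positivity)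
  have hsw := card_swaps_le hY
  rw [hc] at hsw
  have hsw' : (((outerPart X A k).swaps σ).card : ℝ) ≤ (outerPart X A k).missingDim *
      (((outerPart X A k).vertices.card : ℝ) - (k + 1) - (outerPart X A k).degree σ) := by
    exact_mod_cast hsw
  push_cast
  linarith

/-- Equality in the Gershgorin bound at a face where an eigenvector attains its maximum. -/
theorem tight_of_spectralGap_eq {X A : FinComplex V} {k : ℤ} (hk : 0 ≤ k)
    (hA : IsDiscreteBoundary X A k) {z : Finset V → ℝ} {M : ℤ}
    {σ : Finset V} (hσ : σ ∈ relFaces X A k)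
    (hz : (relLaplacian X A k).mulVec (fun τ => z τ.1) ⟨σ, hσ⟩ =
      (((((outerPart X A k).missingDim : ℤ) + 1) * (k + 1) -
        (outerPart X A k).missingDim * (outerPart X A k).vertices.card - M : ℤ) : ℝ) * z σ)
    (h0 : z σ ≠ 0) (hmax : ∀ τ ∈ relFaces X A k, |z τ| ≤ |z σ|)
    (hM : (boundaryCount X A k σ : ℤ) ≤ M) :
    (outerPart X A k).degree σ = 0 ∧ (boundaryCount X A k σ : ℤ) = M ∧
      ((outerPart X A k).swaps σ).card = (outerPart X A k).missingDim *
        ((outerPart X A k).vertices \ σ).card ∧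
      ∀ p ∈ (outerPart X A k).swaps σ, swapTerm z σ p.1 p.2 = - z σ := by
  have hc := (mem_relFaces.mp hσ).2.1
  have hY := (mem_outerPart_iff_mem_relFaces hk hA hc).mpr hσ
  have heq := eigenvector_mul_sq_eq hk hA hσ hz
  have hnn : ∀ p ∈ (outerPart X A k).swaps σ, 0 ≤ z σ ^ 2 + z σ * swapTerm z σ p.1 p.2 :=
    fun p hp => sq_add_mul_swapTerm_nonneg (hmax _ (mem_relFaces_of_mem_swaps hk hA hσ hp))
  have hsum := Finset.sum_nonneg hnn
  have hsw := card_swaps_le hY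
  have hsd := Finset.card_sdiff_add_card_eq_card (subset_vertices hY)
  set Y := outerPart X A k with hYdef
  set h := Y.missingDim with hh
  set d := Y.degree σ with hd
  -- The total loss in passing to the weaker bound: the degree term, the deficit of the boundary
  -- count from `M`, and the missing swaps. Each is nonnegative, while the identity `heq` makes `-E
  -- * z σ ^ 2` nonnegative, so all three vanish.
  set E : ℤ := (h + 1) * d + (M - boundaryCount X A k σ) +
    (h * ((Y.vertices.card : ℤ) - σ.card - d) - (Y.swaps σ).card) with hE
  have hlhs : (((((h : ℤ) + 1) * (k + 1) - h * Y.vertices.card - M : ℤ) : ℝ) -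
      (k + 1 + d - boundaryCount X A k σ - (Y.swaps σ).card)) = -(E : ℝ) := by
    rw [hE, hc]
    push_cast
    ring
  rw [hlhs] at heq
  have hd0 : (0 : ℤ) ≤ (h + 1) * d := by positivity
  have hE0 : 0 ≤ E := by omega
  have hE0' : (0 : ℝ) ≤ E := by exact_mod_cast hE0
  have hsq : 0 < z σ ^ 2 := by positivity
  have hEz : E = 0 := by
    have : (E : ℝ) = 0 := by
      by_contra hne
      have : 0 < (E : ℝ) := lt_of_le_of_ne hE0' (Ne.symm hne)
      have := mul_pos this hsq
      linarith
    exact_mod_cast this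
  have hdz : ((h : ℤ) + 1) * d = 0 := by omega
  have hdeg : d = 0 := by
    rcases mul_eq_zero.mp hdz with h1 | h1 <;> omega
  refine ⟨hdeg, by omega, ?_, ?_⟩
  · have h3 : (h * ((Y.vertices.card : ℤ) - σ.card - d)) = (Y.swaps σ).card := by omega
    have h4 : (Y.vertices.card : ℤ) - σ.card - d = (Y.vertices \ σ).card := by omega
    rw [h4] at h3
    exact_mod_cast h3.symm
  · intro p hp
    rw [hEz] at heq
    simp only [Int.cast_zero, neg_zero, zero_mul] at heq
    have h5 := (Finset.sum_eq_zero_iff_of_nonneg hnn).mp heq.symm p hp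
    have h6 : z σ * (z σ + swapTerm z σ p.1 p.2) = 0 := by linear_combination h5
    linarith [(mul_eq_zero.mp h6).resolve_left h0]

/-- The family `T` of faces of maximal modulus is closed under swaps because sharpness forces
`swapTerm = -z σ`. It finally contains every `k`-face of `X'`, which also makes the boundary count
constant. -/
theorem isBoundaryJoin_of_spectralGap_eq {X A : FinComplex V} {k : ℤ} (hk : 0 ≤ k)
    (hA : IsDiscreteBoundary X A k) (hne : (relFaces X A k).Nonempty) {M : ℤ}
    (hM : ∀ σ ∈ relFaces X A k, (boundaryCount X A k σ : ℤ) ≤ M)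
    (hgap : spectralGap X A k = (((((outerPart X A k).missingDim : ℤ) + 1) * (k + 1) -
        (outerPart X A k).missingDim * (outerPart X A k).vertices.card - M : ℤ) : ℝ)) :
    (outerPart X A k).IsBoundaryJoin (outerPart X A k).missingDim
      ((outerPart X A k).vertices.card - (k + 1).toNat) ∧
      ∀ σ ∈ relFaces X A k, (boundaryCount X A k σ : ℤ) = M := by
  obtain ⟨z, hz, σ₀, hσ₀, h0, hmax⟩ := exists_eigenvector_max hne
  rw [hgap] at hz
  let T : Set (Finset V) := {σ | σ ∈ relFaces X A k ∧ |z σ| = |z σ₀|}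
  have hT0 : ∀ σ ∈ T, z σ ≠ 0 := fun σ hσ => by
    rw [← abs_pos, hσ.2]
    exact abs_pos.mpr h0
  have htight := fun σ (hσ : σ ∈ T) => tight_of_spectralGap_eq hk hA hσ.1 (hz ⟨σ, hσ.1⟩) (hT0 σ hσ)
    (fun τ hτ => hσ.2 ▸ hmax τ hτ) (hM σ hσ.1)
  have hTY : ∀ σ ∈ T, σ ∈ (outerPart X A k).faces := fun σ hσ =>
    (mem_outerPart_iff_mem_relFaces hk hA (mem_relFaces.mp hσ.1).2.1).mpr hσ.1
  have hswapT : ∀ σ ∈ T, ∀ p ∈ (outerPart X A k).swaps σ, insert p.1 (σ.erase p.2) ∈ T := by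
    intro σ hσ p hp
    refine ⟨mem_relFaces_of_mem_swaps hk hA hσ.1 hp, ?_⟩
    rw [← abs_swapTerm, (htight σ hσ).2.2.2 p hp, abs_neg, hσ.2]
  have hnot : ∀ σ ∈ T, ∀ v ∉ σ, insert v σ ∉ (outerPart X A k).faces := by
    intro σ hσ v hv hY
    have hd := (htight σ hσ).1
    rw [degree_eq_card, Finset.card_eq_zero, Finset.filter_eq_empty_iff] at hd
    exact hd (Finset.mem_sdiff.mpr ⟨subset_vertices hY (Finset.mem_insert_self _ _), hv⟩) hY
  obtain ⟨h1, h2⟩ := isBoundaryJoin_of_swaps (c := (k + 1).toNat) (T := T) (σ₀ := σ₀)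
    (fun σ hσ => ⟨hTY σ hσ, by have := (mem_relFaces.mp hσ.1).2.1; omega⟩)
    (by
      intro σ hσ
      have hfil : ((outerPart X A k).vertices \ σ).filter
          (fun v => insert v σ ∉ (outerPart X A k).faces) = (outerPart X A k).vertices \ σ :=
        Finset.filter_true_of_mem fun v hv => hnot σ hσ v (Finset.mem_sdiff.mp hv).2
      have hcard := (htight σ hσ).2.2.1
      rw [card_swaps_eq, hfil] at hcard
      have hle : ∀ v ∈ (outerPart X A k).vertices \ σ,
          (σ.filter (fun u => insert v (σ.erase u) ∈ (outerPart X A k).faces)).card ≤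
            (outerPart X A k).missingDim := fun v hv =>
        card_filter_swap_le (hTY σ hσ) (Finset.mem_sdiff.mp hv).1
          (hnot σ hσ v (Finset.mem_sdiff.mp hv).2)
      -- The swap counts are each at most `h'` and their sum is the largest possible, so each equals
      -- `h'`.
      have hall := (Finset.sum_eq_sum_iff_of_le hle).mp (by
        rw [hcard, Finset.sum_const, smul_eq_mul, mul_comm])
      exact fun v hv => ⟨hnot σ hσ v (Finset.mem_sdiff.mp hv).2, hall v hv⟩)
    hswapT
    (by
      intro σ hσ u v v' hv hv'
      by_contra hne
      have hvm := mem_swaps.mp hv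
      have hvm' := mem_swaps.mp hv'
      have hτ := hswapT σ hσ _ hv
      have hvη : v ∉ σ.erase u := fun h => hvm.1.1 (Finset.mem_of_mem_erase h)
      have hvη' : v' ∉ insert v (σ.erase u) := by
        simp only [Finset.mem_insert, Finset.mem_erase, not_or, not_and]
        exact ⟨Ne.symm hne, fun _ => hvm'.1.1⟩
      have hsw : (v', v) ∈ (outerPart X A k).swaps (insert v (σ.erase u)) := by
        refine mem_swaps.mpr ⟨⟨hvη', Finset.mem_insert_self _ _⟩, hnot _ hτ v' hvη', ?_⟩
        rw [Finset.erase_insert hvη]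
        exact hvm'.2.2
      have e1 := (htight σ hσ).2.2.2 _ hv
      have e2 := (htight σ hσ).2.2.2 _ hv'
      have e3 := (htight _ hτ).2.2.2 _ hsw
      simp only [swapTerm, Finset.erase_insert hvη] at e1 e2 e3
      have s1 := insertSign_mul_self u (σ.erase u)
      have s2 := insertSign_mul_self v (σ.erase u)
      refine hT0 _ hτ ?_
      set a := insertSign u (σ.erase u)
      set b := insertSign v (σ.erase u)
      set c := insertSign v' (σ.erase u)
      set x := z (insert v (σ.erase u))
      set y := z (insert v' (σ.erase u))
      -- With `η = σ \ {u}`, the signed values at `η ∪ {u}`, `η ∪ {v}`, `η ∪ {v'}` would have to be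
      -- pairwise opposite, which forces them to vanish.
      have e4 : b * x = c * y := by
        linear_combination a * e1 - a * e2 - (b * x - c * y) * s1
      have e5 : c * y = - (b * x) := by linear_combination b * e3 - c * y * s2
      have e6 : b * x = 0 := by linarith
      linear_combination b * e6 - x * s2)
    ⟨hσ₀, rfl⟩
  refine ⟨h1, fun σ hσ => (htight σ (h2 σ ?_ ?_)).2.1⟩
  · exact (mem_outerPart_iff_mem_relFaces hk hA (mem_relFaces.mp hσ).2.1).mpr hσ
  · have := (mem_relFaces.mp hσ).2.1
    omega

end FinComplex

/-! ### Isomorphism with the extremal complex -/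

namespace FinComplex

section Iso
variable {V W : Type*} [DecidableEq V] [DecidableEq W]

theorem isomorphic_iff_exists_embedding {Y : FinComplex V} {E : FinComplex W}
    (huniv : ∀ w, w ∈ E.vertices) :
    Isomorphic Y E ↔ ∃ g : W ↪ V, (∀ v, v ∈ Y.vertices ↔ ∃ w, g w = v) ∧
      ∀ ρ, ρ ∈ E.faces ↔ ρ.map g ∈ Y.faces := by
  constructor
  · rintro ⟨f, hf, hf'⟩
    obtain ⟨g, hg⟩ : ∃ g : W ↪ V, ∀ w, g w = (f.symm ⟨w, huniv w⟩).1 :=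
      ⟨⟨fun w => (f.symm ⟨w, huniv w⟩).1, fun a b hab =>
        congrArg Subtype.val (f.symm.injective (Subtype.ext hab))⟩, fun _ => rfl⟩
    refine ⟨g, fun v => ⟨fun hv => ⟨f ⟨v, hv⟩, by simp [hg]⟩, ?_⟩, fun ρ => ⟨fun h => ?_, fun h => ?_⟩⟩
    · rintro ⟨w, rfl⟩
      exact hg w ▸ (f.symm ⟨w, huniv w⟩).2
    · have := hf' (Finset.univ.filter (fun w => w.1 ∈ ρ)) (by
        convert h using 1
        ext w
        simp [huniv w])
      convert this using 1
      ext v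
      simp only [Finset.mem_map, Finset.mem_image, Finset.mem_filter, Finset.mem_univ, true_and, hg,
        Function.Embedding.subtype_apply]
      constructor
      · rintro ⟨w, hw, rfl⟩
        exact ⟨_, ⟨⟨w, huniv w⟩, hw, rfl⟩, rfl⟩
      · rintro ⟨_, ⟨w, hw, rfl⟩, rfl⟩
        exact ⟨w.1, hw, rfl⟩
    · have := hf (Finset.univ.filter (fun v => (f v).1 ∈ ρ)) (by
        convert h using 1
        ext v
        simp only [Finset.mem_map, Finset.mem_filter, Finset.mem_univ, true_and, hg,
          Function.Embedding.subtype_apply]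
        constructor
        · rintro ⟨v, hv, rfl⟩
          exact ⟨_, hv, by simp⟩
        · rintro ⟨w, hw, rfl⟩
          exact ⟨_, by simpa using hw, rfl⟩)
      convert this using 1
      ext w
      simp only [Finset.mem_map, Finset.mem_image, Finset.mem_filter, Finset.mem_univ, true_and,
        Function.Embedding.subtype_apply]
      constructor
      · intro hw
        exact ⟨⟨w, huniv w⟩, ⟨f.symm ⟨w, huniv w⟩, by simpa using hw, by simp⟩, rfl⟩
      · rintro ⟨_, ⟨v, hv, rfl⟩, rfl⟩
        exact hv
  · rintro ⟨g, hg, hface⟩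
    let f : E.vertices ≃ Y.vertices := Equiv.ofBijective
      (fun w => ⟨g w.1, (hg _).mpr ⟨w.1, rfl⟩⟩)
      ⟨fun a b hab => Subtype.ext (g.injective (congrArg Subtype.val hab)), fun v => by
        obtain ⟨w, hw⟩ := (hg v.1).mp v.2
        exact ⟨⟨w, huniv w⟩, Subtype.ext hw⟩⟩
    have hfg : ∀ w, (f w).1 = g w.1 := fun w => rfl
    have hgf : ∀ v, g (f.symm v).1 = v.1 := fun v => by rw [← hfg, Equiv.apply_symm_apply]
    refine ⟨f.symm, fun σ hσ => ?_, fun σ hσ => ?_⟩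
    · rw [hface]
      convert hσ using 1
      rw [← Finset.coe_inj]
      simp only [Finset.coe_map, Finset.coe_image, Set.image_image,
        Function.Embedding.subtype_apply, hgf]
      rfl
    · rw [hface] at hσ
      convert hσ using 1
      rw [← Finset.coe_inj]
      simp only [Finset.coe_map, Finset.coe_image, Set.image_image, Equiv.symm_symm,
        Function.Embedding.subtype_apply, hfg]

theorem mem_slice {n : ℕ} {σ : Finset (Fin n × V)} {i : Fin n} {v : V} :
    v ∈ slice σ i ↔ (i, v) ∈ σ := by
  simp [slice]

theorem mem_join_faces {X : FinComplex V} {Y : FinComplex W} {ρ : Finset (V ⊕ W)} :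
    ρ ∈ (join X Y).faces ↔ ρ.toLeft ∈ X.faces ∧ ρ.toRight ∈ Y.faces := by
  simp only [join, Finset.mem_image, Finset.mem_product, Prod.exists]
  constructor
  · rintro ⟨a, b, h, rfl⟩
    simpa using h
  · intro h
    exact ⟨_, _, h, Finset.toLeft_disjSum_toRight⟩

theorem mem_joinPow_faces {X : FinComplex V} {n : ℕ} {σ : Finset (Fin n × V)} :
    σ ∈ (joinPow X n).faces ↔ ∀ i, slice σ i ∈ X.faces := by
  simp only [joinPow, Finset.mem_filter, Finset.mem_powerset, and_iff_right_iff_imp]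
  rintro h ⟨i, v⟩ hv
  exact Finset.mem_product.mpr ⟨Finset.mem_univ _, subset_vertices (h i) (mem_slice.mpr hv)⟩

end Iso

theorem mem_boundary_simplex_faces {h : ℕ} {σ : Finset (Fin ((h : ℤ) + 1).toNat)} :
    σ ∈ (skeleton (simplex (h : ℤ)) ((h : ℤ) - 1)).faces ↔ ∃ j, j ∉ σ := by
  have hcard : Fintype.card (Fin ((h : ℤ) + 1).toNat) = h + 1 := by
    rw [Fintype.card_fin]
    omega
  have h1 : (∃ j, j ∉ σ) ↔ σ.card < h + 1 := by
    rw [← hcard, Finset.card_lt_iff_ne_univ, ne_eq, Finset.eq_univ_iff_forall, not_forall]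
  rw [h1]
  rw [skeleton, simplex, Finset.mem_filter, and_iff_right (Finset.mem_univ σ), dim]
  constructor
  · rintro (rfl | hle)
    · simp
    · omega
  · intro hlt
    right
    omega

theorem mem_extremalComplex_faces {h n : ℕ} {k : ℤ}
    {ρ : Finset ((Fin ((n : ℤ) - k - 1).toNat × Fin ((h : ℤ) + 1).toNat) ⊕
      Fin (((h : ℤ) + 1) * (k + 1) - h * n - 1 + 1).toNat)} :
    ρ ∈ (extremalComplex h n k).faces ↔ ∀ i, ∃ j, Sum.inl (i, j) ∉ ρ := by
  rw [extremalComplex, mem_join_faces, mem_joinPow_faces]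
  simp only [mem_boundary_simplex_faces, mem_slice, Finset.mem_toLeft]
  exact and_iff_left (Finset.mem_univ _)

/-- The condition excludes `h = 0` with at least one block: the boundary of a point has only the
empty face, so the points of such blocks are not vertices. -/
theorem mem_extremalComplex_vertices {h n : ℕ} {k : ℤ}
    (hr : h ≠ 0 ∨ ((n : ℤ) - k - 1).toNat = 0) (w) :
    w ∈ (extremalComplex h n k).vertices := by
  rw [mem_vertices, mem_extremalComplex_faces]
  intro i
  rcases hr with hr | hr
  · have : Nontrivial (Fin ((h : ℤ) + 1).toNat) := Fin.nontrivial_iff_two_le.mpr (by omega)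
    rcases w with ⟨i', j'⟩ | t
    · obtain ⟨j, hj⟩ := exists_ne j'
      exact ⟨j, by simp [hj]⟩
    · exact ⟨Classical.arbitrary _, by simp⟩
  · exact absurd i.2 (by omega)

section
variable {V : Type*} [DecidableEq V]

theorem IsBoundaryJoin.ne_zero_or {Y : FinComplex V} {h r : ℕ} (hY : Y.IsBoundaryJoin h r) :
    h ≠ 0 ∨ r = 0 := by
  obtain ⟨P, hP, hc, -, hf⟩ := hY
  by_contra! hcon
  obtain ⟨v, hv⟩ := Finset.card_eq_one.mp ((hc ⟨0, by omega⟩).trans (by omega))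
  have hvY : v ∈ Y.vertices := hP ⟨0, by omega⟩ (by simp [hv])
  refine ((hf {v}).mp (mem_vertices.mp hvY)).2 ⟨0, by omega⟩ ?_
  rw [hv]

theorem isBoundaryJoin_iff_isomorphic_of_ne_zero {Y : FinComplex V} {h : ℕ} {k : ℤ}
    (hr : h ≠ 0 ∨ ((Y.vertices.card : ℤ) - k - 1).toNat = 0)
    (hn : 0 ≤ (Y.vertices.card : ℤ) - k - 1)
    (hs : 0 ≤ ((h : ℤ) + 1) * (k + 1) - h * Y.vertices.card) :
    Y.IsBoundaryJoin h ((Y.vertices.card : ℤ) - k - 1).toNat ↔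
      Isomorphic Y (extremalComplex h Y.vertices.card k) := by
  rw [isomorphic_iff_exists_embedding (mem_extremalComplex_vertices hr)]
  simp only [mem_extremalComplex_faces]
  have hh : ((h : ℤ) + 1).toNat = h + 1 := by omega
  constructor
  · rintro ⟨P, hP, hc, hd, hf⟩
    set S := Y.vertices \ Finset.univ.biUnion P with hS
    have hcard : (Finset.univ.biUnion P).card =
        ((Y.vertices.card : ℤ) - k - 1).toNat * (h + 1) := by
      rw [Finset.card_biUnion fun i _ j _ hij => hd i j hij]
      simp [hc]
    -- The vertices outside the blocks number `n - (n - k - 1)(h + 1) = (h + 1)(k + 1) - hn`.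
    have hSc : S.card = (((h : ℤ) + 1) * (k + 1) - h * Y.vertices.card - 1 + 1).toNat := by
      have h1 := Finset.card_sdiff_add_card_eq_card
        (Finset.biUnion_subset.mpr fun i (_ : i ∈ Finset.univ) => hP i)
      rw [hcard, ← hS] at h1
      zify at h1 ⊢
      rw [Int.toNat_of_nonneg hn] at h1
      rw [Int.toNat_of_nonneg (by omega)]
      linear_combination h1
    let e : ∀ i, Fin ((h : ℤ) + 1).toNat ≃ P i := fun i =>
      (Finset.equivFinOfCardEq ((hc i).trans hh.symm)).symm
    let e' : Fin (((h : ℤ) + 1) * (k + 1) - h * Y.vertices.card - 1 + 1).toNat ≃ S :=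
      (Finset.equivFinOfCardEq hSc).symm
    have hdis : ∀ i x, x ∈ P i → x ∉ S := fun i x hx hxS =>
      (Finset.mem_sdiff.mp hxS).2 (Finset.mem_biUnion.mpr ⟨i, Finset.mem_univ _, hx⟩)
    refine ⟨⟨Sum.elim (fun p => (e p.1 p.2).1) (fun t => (e' t).1), ?_⟩, fun v => ?_, fun ρ => ?_⟩
    · rintro (⟨i, j⟩ | t) (⟨i', j'⟩ | t') heq
      · simp only [Sum.elim_inl] at heq
        have : i = i' := by
          by_contra hne
          exact Finset.disjoint_left.mp (hd i i' hne) (e i j).2 (heq ▸ (e i' j').2)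
        subst this
        rw [(e i).injective (Subtype.ext heq)]
      · simp only [Sum.elim_inl, Sum.elim_inr] at heq
        exact absurd (heq ▸ (e' t').2) (hdis i _ (e i j).2)
      · simp only [Sum.elim_inl, Sum.elim_inr] at heq
        exact absurd (heq ▸ (e' t).2) (hdis i' _ (e i' j').2)
      · simp only [Sum.elim_inr] at heq
        rw [e'.injective (Subtype.ext heq)]
    · constructor
      · intro hv
        by_cases hvS : v ∈ S
        · exact ⟨Sum.inr (e'.symm ⟨v, hvS⟩), by simp⟩
        · rw [hS, Finset.mem_sdiff, not_and, not_not] at hvS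
          obtain ⟨i, -, hi⟩ := Finset.mem_biUnion.mp (hvS hv)
          exact ⟨Sum.inl (i, (e i).symm ⟨v, hi⟩), by simp⟩
      · rintro ⟨⟨i, j⟩ | t, rfl⟩
        · exact hP i (e i j).2
        · exact (Finset.mem_sdiff.mp (e' t).2).1
    · rw [hf, and_iff_right]
      · refine forall_congr' fun i => ?_
        rw [Finset.not_subset]
        constructor
        · rintro ⟨j, hj⟩
          refine ⟨e i j, (e i j).2, fun hmem => hj ?_⟩
          rw [← Finset.mem_map' (f := ⟨Sum.elim (fun p => (e p.1 p.2).1) (fun t => (e' t).1), _⟩)]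
          exact hmem
        · rintro ⟨x, hx, hxρ⟩
          refine ⟨(e i).symm ⟨x, hx⟩, fun hj => hxρ ?_⟩
          exact Finset.mem_map.mpr ⟨_, hj, by simp⟩
      · intro v hv
        obtain ⟨⟨i, j⟩ | t, -, rfl⟩ := Finset.mem_map.mp hv
        · exact hP i (e i j).2
        · exact (Finset.mem_sdiff.mp (e' t).2).1
  · rintro ⟨g, hg, hface⟩
    refine ⟨fun i => Finset.univ.map ⟨fun j => g (Sum.inl (i, j)), fun a b hab => ?_⟩,
      fun i v hv => ?_, fun i => ?_, fun i j hij => ?_, fun τ => ?_⟩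
    · simpa using g.injective hab
    · obtain ⟨j, -, rfl⟩ := Finset.mem_map.mp hv
      exact (hg _).mpr ⟨_, rfl⟩
    · simp
    · rw [Finset.disjoint_left]
      intro x hx hx'
      obtain ⟨a, -, rfl⟩ := Finset.mem_map.mp hx
      obtain ⟨b, -, hb⟩ := Finset.mem_map.mp hx'
      have := g.injective hb
      simp only [Sum.inl.injEq, Prod.mk.injEq] at this
      exact hij this.1.symm
    · have hsub : ∀ τ ⊆ Y.vertices, τ ∈ Y.faces ↔ ∀ i, ¬ Finset.univ.map
          (⟨fun j => g (Sum.inl (i, j)), fun a b hab => by simpa using g.injective hab⟩ :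
            Fin ((h : ℤ) + 1).toNat ↪ V) ⊆ τ := by
        intro τ hτ
        obtain ⟨ρ, rfl⟩ : ∃ ρ : Finset _, τ = ρ.map g := by
          refine ⟨Finset.univ.filter (fun w => g w ∈ τ), ?_⟩
          ext v
          simp only [Finset.mem_map, Finset.mem_filter, Finset.mem_univ, true_and]
          constructor
          · intro hv
            obtain ⟨w, rfl⟩ := (hg v).mp (hτ hv)
            exact ⟨w, hv, rfl⟩
          · rintro ⟨w, hw, rfl⟩
            exact hw
        rw [← hface]
        refine forall_congr' fun i => ?_
        rw [Finset.not_subset]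
        constructor
        · rintro ⟨j, hj⟩
          exact ⟨g (Sum.inl (i, j)), Finset.mem_map.mpr ⟨j, Finset.mem_univ _, rfl⟩,
            fun hm => hj ((Finset.mem_map' g).mp hm)⟩
        · rintro ⟨x, hx, hxρ⟩
          obtain ⟨j, -, rfl⟩ := Finset.mem_map.mp hx
          exact ⟨j, fun hj => hxρ ((Finset.mem_map' g).mpr hj)⟩
      constructor
      · exact fun h => ⟨subset_vertices h, (hsub τ (subset_vertices h)).mp h⟩
      · rintro ⟨h1, h2⟩
        exact (hsub τ h1).mpr h2

theorem card_vertices_eq_of_isomorphic {W : Type*} [DecidableEq W] {Y : FinComplex V}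
    {E : FinComplex W} (h : Isomorphic Y E) : Y.vertices.card = E.vertices.card := by
  obtain ⟨f, -⟩ := h
  simpa using Fintype.card_congr f

/-- In the degenerate case `h = 0`, `n > k + 1` both sides fail: a block would be a single vertex
that is not a face, and the extremal complex has at most `k + 1` vertices. -/
theorem isBoundaryJoin_iff_isomorphic {Y : FinComplex V} {h : ℕ} {k : ℤ}
    (hn : 0 ≤ (Y.vertices.card : ℤ) - k - 1)
    (hs : 0 ≤ ((h : ℤ) + 1) * (k + 1) - h * Y.vertices.card) :
    Y.IsBoundaryJoin h ((Y.vertices.card : ℤ) - k - 1).toNat ↔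
      Isomorphic Y (extremalComplex h Y.vertices.card k) := by
  constructor
  · exact fun hY => (isBoundaryJoin_iff_isomorphic_of_ne_zero hY.ne_zero_or hn hs).mp hY
  · intro hY
    refine (isBoundaryJoin_iff_isomorphic_of_ne_zero ?_ hn hs).mpr hY
    by_contra! hcon
    obtain ⟨h0, hr⟩ := hcon
    subst h0
    have hcard := card_vertices_eq_of_isomorphic hY
    have hle : (extremalComplex 0 Y.vertices.card k).vertices ⊆
        Finset.univ.map Function.Embedding.inr := by
      intro w hw
      rcases w with ⟨i, j⟩ | t
      · obtain ⟨j', hj'⟩ := mem_extremalComplex_faces.mp (mem_vertices.mp hw) i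
        refine absurd ?_ hj'
        have : j' = j := Fin.ext (by omega)
        simp [this]
      · simp
    have := Finset.card_le_card hle
    rw [← hcard, Finset.card_map, Finset.card_univ, Fintype.card_fin] at this
    push_cast at this hs
    omega

end
end FinComplex

/-! ### The determinant eigenvector -/

namespace FinComplex

variable {V : Type*}

section
variable [DecidableEq V]

/-- The vectors attached to the vertices: those at the points `y` form the standard basis, and the
vectors in each block `P i` sum to zero, where `p i` is the only point of `P i` outside `y`. -/
theorem exists_blockVector {r m : ℕ} (P : Fin r → Finset V)
    (hd : ∀ i j, i ≠ j → Disjoint (P i) (P j)) (p : Fin r → V) (hp : ∀ i, p i ∈ P i)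
    (y : Fin m → V) (hy : Function.Injective y) (hpy : ∀ i j, p i ≠ y j) :
    ∃ w : V → Fin m → ℝ, (∀ a, w (y a) = Pi.single a 1) ∧
      ∀ i, ∑ x ∈ P i, w x = 0 := by
  classical
  -- The vector at `p i` is minus the sum of the basis vectors at the points `y j` of `P i`;
  -- vertices that are neither a `y j` nor a `p i` get zero.
  refine ⟨fun x j => if x = y j then 1 else if ∃ i, x = p i ∧ y j ∈ P i then -1 else 0, ?_, ?_⟩
  · intro a
    funext j
    by_cases h : a = j
    · subst h
      simp
    · have h1 : y a ≠ y j := fun e => h (hy e)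
      have h2 : ¬ ∃ i, y a = p i ∧ y j ∈ P i := fun ⟨i, hi, _⟩ => hpy i a hi.symm
      simp [h1, h2, Ne.symm h]
  · intro i
    funext j
    rw [Finset.sum_apply, Pi.zero_apply]
    have huniq : ∀ x ∈ P i, (∃ i', x = p i' ∧ y j ∈ P i') → x = p i ∧ y j ∈ P i := by
      rintro x hx ⟨i', rfl, hj⟩
      have : i' = i := by
        by_contra hne
        exact Finset.disjoint_left.mp (hd i' i hne) (hp i') hx
      subst this
      exact ⟨rfl, hj⟩
    by_cases hj : y j ∈ P i
    · have hsub : ∀ x ∈ P i, (if x = y j then (1 : ℝ) else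
          if ∃ i, x = p i ∧ y j ∈ P i then -1 else 0) =
          (if x = y j then 1 else 0) + (if x = p i then -1 else 0) := by
        intro x hx
        by_cases h1 : x = y j
        · have h2 : x ≠ p i := fun e => hpy i j (e ▸ h1)
          simp [h1, (hpy i j).symm]
        · by_cases h2 : x = p i
          · have h3 : ∃ i', x = p i' ∧ y j ∈ P i' := ⟨i, h2, hj⟩
            rw [if_neg h1, if_pos h3, if_neg h1, if_pos h2, zero_add]
          · have h3 : ¬ ∃ i', x = p i' ∧ y j ∈ P i' := fun h => h2 (huniq x hx h).1
            rw [if_neg h1, if_neg h3, if_neg h1, if_neg h2, zero_add]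
      rw [Finset.sum_congr rfl hsub, Finset.sum_add_distrib, Finset.sum_ite_eq_of_mem' _ _ _ hj,
        Finset.sum_ite_eq_of_mem' _ _ _ (hp i)]
      norm_num
    · refine Finset.sum_eq_zero fun x hx => ?_
      have hne : x ≠ y j := fun e => hj (e ▸ hx)
      rw [if_neg hne, if_neg fun h => hj (huniq x hx h).2]

end

section Order
variable [LinearOrder V]

/-- The determinant of the vectors attached to the elements of `σ`, in increasing order. -/
noncomputable def faceDet {m : ℕ} (w : V → Fin m → ℝ) (σ : Finset V) : ℝ :=
  if h : σ.card = m then Matrix.detRowAlternating (fun a => w (σ.orderEmbOfFin h a)) else 0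

/-- In increasing order, the row of `u` stands behind as many rows as `η` has elements below `u`;
moving it to the front costs exactly the sign `insertSign u η`. -/
theorem faceDet_insert {q : ℕ} (w : V → Fin (q + 1) → ℝ) {η : Finset V} (hη : η.card = q)
    {u : V} (hu : u ∉ η) :
    faceDet w (insert u η) = insertSign u η *
      Matrix.detRowAlternating (Matrix.vecCons (w u) fun a => w (η.orderEmbOfFin hη a)) := by
  have hc : (insert u η).card = q + 1 := by rw [Finset.card_insert_of_notMem hu, hη]
  rw [faceDet, dif_pos hc]
  set e := (insert u η).orderEmbOfFin hc with he
  obtain ⟨p, hp⟩ : ∃ p, e p = u := by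
    have : u ∈ Set.range e := by
      rw [he, Finset.range_orderEmbOfFin]
      exact Finset.mem_coe.mpr (Finset.mem_insert_self _ _)
    exact this
  have hmem : ∀ a, e (p.succAbove a) ∈ η := by
    intro a
    have h1 : e (p.succAbove a) ∈ insert u η := Finset.orderEmbOfFin_mem _ _ _
    refine (Finset.mem_insert.mp h1).resolve_left fun h2 => ?_
    exact Fin.succAbove_ne p a (e.injective (h2.trans hp.symm))
  have hsucc : (fun a => e (p.succAbove a)) = η.orderEmbOfFin hη :=
    Finset.orderEmbOfFin_unique hη hmem
      (e.strictMono.comp (Fin.strictMono_succAbove p))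
  have hins : (fun a => w (e a)) =
      p.insertNth (w u) (fun a => w (η.orderEmbOfFin hη a)) := by
    rw [Fin.eq_insertNth_iff]
    refine ⟨by rw [hp], ?_⟩
    funext a
    rw [← hsucc]
    rfl
  have hcount : (η.filter (fun x => x < u)).card = (p : ℕ) := by
    have h1 : η.filter (fun x => x < u) = (Finset.Iio p).map e.toEmbedding := by
      ext x
      simp only [Finset.mem_filter, Finset.mem_map, Finset.mem_Iio, RelEmbedding.coe_toEmbedding]
      constructor
      · rintro ⟨hx, hxu⟩
        have : x ∈ Set.range e := by
          rw [he, Finset.range_orderEmbOfFin]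
          exact Finset.mem_coe.mpr (Finset.mem_insert_of_mem hx)
        obtain ⟨b, rfl⟩ := this
        rw [← hp] at hxu
        exact ⟨b, e.lt_iff_lt.mp hxu, rfl⟩
      · rintro ⟨b, hb, rfl⟩
        have hlt : e b < u := hp ▸ e.lt_iff_lt.mpr hb
        exact ⟨(Finset.mem_insert.mp (Finset.orderEmbOfFin_mem _ hc b)).resolve_left hlt.ne, hlt⟩
    rw [h1, Finset.card_map, Fin.card_Iio]
  rw [hins, AlternatingMap.map_insertNth, insertSign, hcount, zsmul_eq_mul]
  push_cast
  rfl

theorem faceDet_eq_one {m : ℕ} (w : V → Fin m → ℝ) {σ : Finset V} (h : σ.card = m)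
    (hw : ∀ a, w (σ.orderEmbOfFin h a) = Pi.single a 1) : faceDet w σ = 1 := by
  rw [faceDet, dif_pos h]
  have : (fun a => w (σ.orderEmbOfFin h a)) = (1 : Matrix (Fin m) (Fin m) ℝ) := by
    funext a
    rw [hw]
    funext b
    rw [Matrix.one_apply, Pi.single_apply]
    simp only [eq_comm]
  rw [this]
  exact Matrix.det_one

/-- If the vectors of a set `G ⊆ σ ∪ {v}` containing `u` and `v` sum to zero, then exchanging `u`
for `v` contributes `-z σ` to the Laplacian of `z = faceDet w`. -/
theorem swapTerm_faceDet {q : ℕ} (w : V → Fin (q + 1) → ℝ) {σ G : Finset V}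
    (hσ : σ.card = q + 1) {u v : V} (hu : u ∈ σ) (hv : v ∉ σ) (hG : G ⊆ insert v σ)
    (huG : u ∈ G) (hvG : v ∈ G) (hsum : ∑ x ∈ G, w x = 0) :
    swapTerm (faceDet w) σ v u = - faceDet w σ := by
  have hη : (σ.erase u).card = q := by
    have := Finset.card_erase_add_one hu
    omega
  set η := σ.erase u with hηdef
  have huv : v ≠ u := fun e => hv (e ▸ hu)
  have huη : u ∉ η := Finset.notMem_erase u σ
  have hvη : v ∉ η := fun h => hv (Finset.mem_of_mem_erase h)
  set D : V → ℝ := fun x => Matrix.detRowAlternating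
    (Matrix.vecCons (w x) fun a => w (η.orderEmbOfFin hη a)) with hD
  have hDsum : ∑ x ∈ G, D x = 0 := by
    let L : (Fin (q + 1) → ℝ) →ₗ[ℝ] ℝ :=
      (Matrix.detRowAlternating (R := ℝ) (n := Fin (q + 1))).toMultilinearMap.toLinearMap
        (Matrix.vecCons 0 fun a => w (η.orderEmbOfFin hη a)) 0
    have hL : ∀ x, D x = L (w x) := by
      intro x
      change _ = Matrix.detRowAlternating (Function.update
        (Matrix.vecCons 0 fun a => w (η.orderEmbOfFin hη a)) 0 (w x))
      rw [Matrix.vecCons, Fin.update_cons_zero]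
      rfl
    simp_rw [hL]
    rw [← map_sum, hsum, map_zero]
  -- The elements of `G` other than `u` and `v` lie in `η`, so their vector occurs twice among the
  -- rows.
  have hzero : ∀ x ∈ (G.erase v).erase u, D x = 0 := by
    intro x hx
    simp only [Finset.mem_erase] at hx
    have hxη : x ∈ η := Finset.mem_erase.mpr
      ⟨hx.1, (Finset.mem_insert.mp (hG hx.2.2)).resolve_left hx.2.1⟩
    obtain ⟨b, hb⟩ : x ∈ Set.range (η.orderEmbOfFin hη) := by
      rw [Finset.range_orderEmbOfFin]
      exact hxη
    refine AlternatingMap.map_eq_zero_of_eq _ _ (i := 0) (j := b.succ) ?_ (Fin.succ_ne_zero b).symm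
    simp [hb]
  have huG' : u ∈ G.erase v := Finset.mem_erase.mpr ⟨huv.symm, huG⟩
  rw [← Finset.add_sum_erase _ _ hvG, ← Finset.add_sum_erase _ _ huG',
    Finset.sum_eq_zero hzero] at hDsum
  have h1 : faceDet w σ = insertSign u η * D u := by
    rw [← Finset.insert_erase hu]
    exact faceDet_insert w hη huη
  have h2 : faceDet w (insert v η) = insertSign v η * D v := faceDet_insert w hη hvη
  rw [swapTerm, ← hηdef, h2, h1]
  linear_combination insertSign u η * D v * insertSign_mul_self v η + insertSign u η * hDsum

end Order
end FinComplex

/-! ### The bound is attained on joins of boundaries -/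

namespace FinComplex

variable {V : Type*} [LinearOrder V]

theorem spectralGap_le_of_eigenvector {X A : FinComplex V} {k : ℤ}
    {z : Finset V → ℝ} {μ : ℝ} {σ₀ : Finset V} (hσ₀ : σ₀ ∈ relFaces X A k) (h0 : z σ₀ ≠ 0)
    (hz : ∀ σ : relFaces X A k, (relLaplacian X A k).mulVec (fun τ => z τ.1) σ = μ * z σ.1) :
    spectralGap X A k ≤ μ := by
  refine (spectralGap_isLeast X A k ⟨σ₀, hσ₀⟩).2 ?_
  refine Module.End.hasEigenvalue_of_hasEigenvector (x := fun τ => z τ.1)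
    ⟨Module.End.mem_eigenspace_iff.mpr ?_, fun h => h0 (congrFun h ⟨σ₀, hσ₀⟩)⟩
  rw [Matrix.toLin'_apply]
  funext σ
  exact hz σ

theorem spectralGap_le_of_isBoundaryJoin {X A : FinComplex V} {k : ℤ} (hk : 0 ≤ k)
    (hA : IsDiscreteBoundary X A k) {r : ℕ} {c : ℤ}
    (hr : (r : ℤ) = ((outerPart X A k).vertices.card : ℤ) - k - 1)
    (hY : (outerPart X A k).IsBoundaryJoin (outerPart X A k).missingDim r)
    (hb : ∀ σ ∈ relFaces X A k, (boundaryCount X A k σ : ℤ) = c) :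
    spectralGap X A k ≤ (k : ℝ) + 1 - c - (outerPart X A k).missingDim * r := by
  obtain ⟨q, rfl⟩ := Int.eq_ofNat_of_zero_le hk
  set Y := outerPart X A q with hYdef
  obtain ⟨P, hP, hc, hd, hf⟩ := hY
  have hPn : ∀ i, P i ∉ Y.faces := fun i h => ((hf _).mp h).2 i subset_rfl
  have hmemR : ∀ σ : Finset V, σ.card = q + 1 → (σ ∈ Y.faces ↔ σ ∈ relFaces X A q) :=
    fun σ h => mem_outerPart_iff_mem_relFaces hk hA (by omega)
  have hinj : ∀ f : Fin r → V, (∀ i, f i ∈ P i) → (Finset.univ.image f).card = r := by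
    intro f hfP
    rw [Finset.card_image_of_injective, Finset.card_univ, Fintype.card_fin]
    intro i j hij
    by_contra hne
    exact Finset.disjoint_left.mp (hd i j hne) (hfP i) (hij ▸ hfP j)
  -- A face omits a point of each of the `r` disjoint blocks, so it has at most `n' - r = q + 1`
  -- elements.
  have hmaxcard : ∀ τ ∈ Y.faces, τ.card ≤ q + 1 := by
    intro τ hτ
    choose f hfP hfτ using fun i => Finset.not_subset.mp (((hf τ).mp hτ).2 i)
    have h1 : Finset.univ.image f ⊆ Y.vertices \ τ := by
      intro x hx
      obtain ⟨i, -, rfl⟩ := Finset.mem_image.mp hx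
      exact Finset.mem_sdiff.mpr ⟨hP i (hfP i), hfτ i⟩
    have h2 := Finset.card_le_card h1
    rw [hinj f hfP] at h2
    have h3 := Finset.card_sdiff_add_card_eq_card (subset_vertices hτ)
    omega
  choose p hp using fun i => Finset.card_pos.mp (by rw [hc i]; omega : 0 < (P i).card)
  have hpW : Finset.univ.image p ⊆ Y.vertices := by
    intro x hx
    obtain ⟨i, -, rfl⟩ := Finset.mem_image.mp hx
    exact hP i (hp i)
  -- The complement of a transversal is a `k`-face; its vertices carry the standard basis, so the
  -- eigenvector takes the value `1` there and is nonzero.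
  set σ₀ := Y.vertices \ Finset.univ.image p with hσ₀
  have hpσ : ∀ i, p i ∉ σ₀ := fun i h =>
    (Finset.mem_sdiff.mp h).2 (Finset.mem_image_of_mem p (Finset.mem_univ i))
  have hc₀ : σ₀.card = q + 1 := by
    have := Finset.card_sdiff_add_card_eq_card hpW
    rw [hinj p hp, ← hσ₀] at this
    omega
  have hσ₀Y : σ₀ ∈ Y.faces :=
    (hf _).mpr ⟨Finset.sdiff_subset, fun i h => hpσ i (h (hp i))⟩
  obtain ⟨w, hw1, hw2⟩ := exists_blockVector P hd p hp (σ₀.orderEmbOfFin hc₀)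
    (σ₀.orderEmbOfFin hc₀).injective
    (fun i j e => hpσ i (e ▸ Finset.orderEmbOfFin_mem _ _ _))
  refine spectralGap_le_of_eigenvector (z := faceDet w) ((hmemR σ₀ hc₀).mp hσ₀Y)
    (by rw [faceDet_eq_one w hc₀ hw1]; exact one_ne_zero) ?_
  rintro ⟨σ, hσ⟩
  have hσc : σ.card = q + 1 := by
    have := (mem_relFaces.mp hσ).2.1
    omega
  have hσY := (hmemR σ hσc).mpr hσ
  have hnot : ∀ v ∉ σ, insert v σ ∉ Y.faces := by
    intro v hv h
    have := hmaxcard _ h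
    rw [Finset.card_insert_of_notMem hv] at this
    omega
  have hblock : ∀ v ∈ Y.vertices \ σ, ∃ i, v ∈ P i ∧ P i ⊆ insert v σ := by
    intro v hv
    obtain ⟨hvW, hvσ⟩ := Finset.mem_sdiff.mp hv
    have h1 := hnot v hvσ
    rw [hf, not_and, not_forall] at h1
    obtain ⟨i, hi⟩ := h1 (Finset.insert_subset hvW (subset_vertices hσY))
    rw [not_not] at hi
    refine ⟨i, ?_, hi⟩
    by_contra hvP
    exact ((hf σ).mp hσY).2 i ((Finset.subset_insert_iff_of_notMem hvP).mp hi)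
  have hterm : ∀ s ∈ Y.swaps σ, swapTerm (faceDet w) σ s.1 s.2 = - faceDet w σ := by
    intro s hs
    obtain ⟨⟨h1, h2⟩, -, h4⟩ := mem_swaps.mp hs
    obtain ⟨i, hvi, hi⟩ := hblock s.1 (Finset.mem_sdiff.mpr
      ⟨subset_vertices h4 (Finset.mem_insert_self _ _), h1⟩)
    exact swapTerm_faceDet w hσc h2 h1 hi (mem_of_mem_swaps hs (hPn i) hi) hvi (hw2 i)
  have hdeg : Y.degree σ = 0 := by
    rw [degree_eq_card, Finset.card_eq_zero, Finset.filter_eq_empty_iff]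
    exact fun v hv => hnot v (Finset.mem_sdiff.mp hv).2
  have hout := Finset.card_sdiff_add_card_eq_card (subset_vertices hσY)
  -- The upper bound holds in general. For the lower one, `v ∉ σ` completes a block `P i`, and each
  -- of the `h'` other elements of that block can be exchanged for `v`.
  have hcard : (Y.swaps σ).card = Y.missingDim * r := by
    refine le_antisymm ?_ ?_
    · have := card_swaps_le hσY
      have h2 : (Y.vertices.card : ℤ) - σ.card - Y.degree σ = r := by omega
      rw [h2] at this
      exact_mod_cast this
    · have hfil : (Y.vertices \ σ).filter (fun v => insert v σ ∉ Y.faces) = Y.vertices \ σ :=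
        Finset.filter_true_of_mem fun v hv => hnot v (Finset.mem_sdiff.mp hv).2
      have hr' : (Y.vertices \ σ).card = r := by omega
      rw [card_swaps_eq, hfil, mul_comm, ← hr', ← smul_eq_mul]
      refine Finset.card_nsmul_le_sum _ _ _ fun v hv => ?_
      obtain ⟨i, hvi, hi⟩ := hblock v hv
      have hvσ := (Finset.mem_sdiff.mp hv).2
      have h1 : ((P i).erase v).card = Y.missingDim := by
        rw [Finset.card_erase_of_mem hvi, hc i]
        rfl
      rw [← h1]
      refine Finset.card_le_card fun u hu => ?_
      obtain ⟨huv, huP⟩ := Finset.mem_erase.mp hu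
      refine Finset.mem_filter.mpr ⟨(Finset.mem_insert.mp (hi huP)).resolve_left huv, ?_⟩
      refine (hf _).mpr ⟨Finset.insert_subset (Finset.mem_sdiff.mp hv).1
        ((Finset.erase_subset _ _).trans (subset_vertices hσY)), fun j hj => ?_⟩
      by_cases hij : i = j
      · subst hij
        simpa [huv] using hj huP
      · have hvj : v ∉ P j := Finset.disjoint_left.mp (hd i j hij) hvi
        exact ((hf σ).mp hσY).2 j (((Finset.subset_insert_iff_of_notMem hvj).mp hj).trans
          (Finset.erase_subset _ _))
  rw [relLaplacian_mulVec hk hA, Finset.sum_congr rfl hterm, Finset.sum_const, nsmul_eq_mul,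
    ← hYdef, hcard, hdeg]
  have hbσ : (boundaryCount X A q σ : ℝ) = c := by exact_mod_cast hb σ hσ
  rw [hbσ]
  push_cast
  ring

end FinComplex

/-! ### The theorem -/

open FinComplex

theorem theorem4p2 {V : Type*} [LinearOrder V] (X A : FinComplex V) (k : ℤ) (hk : 1 ≤ k)
    (hA : FinComplex.IsDiscreteBoundary X A k)
    (hne : (FinComplex.relFaces X A k).Nonempty) :
    let X' : FinComplex V := FinComplex.outerPart X A k
    let h' : ℕ := X'.missingDim
    let n' : ℕ := X'.vertices.card
    let b : Finset V → ℤ := fun σ => (FinComplex.boundaryCount X A k σ : ℤ)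
    let m : ℤ := (X'.facesOfDim k).inf' (FinComplex.outerPart_nonempty hne)
      (fun σ => ((h' : ℤ) + 1) * (X'.degree σ : ℤ) - b σ)
    let M : ℤ := (X'.facesOfDim k).sup' (FinComplex.outerPart_nonempty hne) b
    let B₁ : ℤ := m + (((h' : ℤ) + 1) * (k + 1) - h' * n')
    let B₂ : ℤ := ((h' : ℤ) + 1) * (k + 1) - h' * n' - M
    (B₁ : ℝ) ≤ FinComplex.spectralGap X A k ∧
    B₂ ≤ B₁ ∧
    (FinComplex.spectralGap X A k = (B₂ : ℝ) ↔
      (0 ≤ (n' : ℤ) - k - 1 ∧ 0 ≤ ((h' : ℤ) + 1) * (k + 1) - h' * n' ∧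
        FinComplex.Isomorphic X' (FinComplex.extremalComplex h' n' k)) ∧
      ∃ c : ℤ, ∀ σ ∈ X'.facesOfDim k, b σ = c) := by
  intro X' h' n' b m M B₁ B₂
  have hk0 : 0 ≤ k := by omega
  have hR : X'.facesOfDim k = relFaces X A k := facesOfDim_outerPart hk0 hA
  have hB₁ : (B₁ : ℝ) ≤ spectralGap X A k := by
    obtain ⟨σ, hσ, hle⟩ := exists_le_spectralGap hk0 hA hne
    refine le_trans ?_ hle
    rw [Int.cast_le]
    have hm : m ≤ ((h' : ℤ) + 1) * (X'.degree σ : ℤ) - b σ :=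
      Finset.inf'_le (fun σ => ((h' : ℤ) + 1) * (X'.degree σ : ℤ) - b σ) (hR ▸ hσ)
    exact Int.add_le_add_right hm _
  have hbM : ∀ σ ∈ X'.facesOfDim k, b σ ≤ M := fun σ hσ => Finset.le_sup' b hσ
  have hB₂ : B₂ ≤ B₁ := by
    have hm : -M ≤ m := by
      refine Finset.le_inf' _ _ fun σ hσ => ?_
      have h1 := hbM σ hσ
      have h2 : (0 : ℤ) ≤ ((h' : ℤ) + 1) * (X'.degree σ : ℤ) := by positivity
      linarith
    simp only [B₁, B₂]
    linarith
  refine ⟨hB₁, hB₂, ?_, ?_⟩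
  · intro hgap
    obtain ⟨hjoin, hconst⟩ := isBoundaryJoin_of_spectralGap_eq hk0 hA hne (M := M)
      (fun σ hσ => hbM σ (hR ▸ hσ)) hgap
    obtain ⟨σ, hσ⟩ := outerPart_nonempty hne
    obtain ⟨hσY, hσc⟩ := mem_facesOfDim.mp hσ
    have hle := Finset.card_le_card (subset_vertices hσY)
    have hn : 0 ≤ (n' : ℤ) - k - 1 := by
      simp only [n', X']
      omega
    have hr : n' - (k + 1).toNat = ((n' : ℤ) - k - 1).toNat := by omega
    have hs : 0 ≤ ((h' : ℤ) + 1) * (k + 1) - h' * n' := by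
      -- Disjoint blocks fit into the vertex set: `(n' - k - 1)(h' + 1) ≤ n'`, which rearranges to
      -- the claim.
      have h1 : ((n' - (k + 1).toNat) * (h' + 1) : ℕ) ≤ n' := hjoin.card_mul_le
      zify at h1
      rw [hr, Int.toNat_of_nonneg hn] at h1
      linarith
    refine ⟨⟨hn, hs, (isBoundaryJoin_iff_isomorphic hn hs).mp ?_⟩, M, fun σ hσ =>
      hconst σ (hR ▸ hσ)⟩
    exact hr ▸ hjoin
  · rintro ⟨⟨hn, hs, hiso⟩, c, hb⟩
    have hjoin := (isBoundaryJoin_iff_isomorphic hn hs).mpr hiso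
    have hM : M = c := by
      obtain ⟨σ, hσ, hσM⟩ := Finset.exists_mem_eq_sup' (outerPart_nonempty hne) b
      exact hσM.trans (hb σ hσ)
    have hle := spectralGap_le_of_isBoundaryJoin hk0 hA (Int.toNat_of_nonneg hn) hjoin
      (fun σ hσ => hb σ (hR ▸ hσ))
    refine le_antisymm (hle.trans (le_of_eq ?_)) (le_trans (Int.cast_le.mpr hB₂) hB₁)
    have hr : (((((outerPart X A k).vertices.card : ℤ) - k - 1).toNat : ℕ) : ℝ) =
        (n' : ℝ) - k - 1 := by
      have := Int.toNat_of_nonneg hn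
      exact_mod_cast congrArg (Int.cast : ℤ → ℝ) this
    rw [hr]
    simp only [B₂, hM]
    push_cast
    ring
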